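/- Let $A$ be an alphabet and let $\varphi$ be an LTL formula over $A$ in negation normal form, i.e. built from literals $a$, $\neg a$ ($a\in A$) with $\vee,\wedge,\mathsf X,\mathsf F,\mathsf G,\mathsf U,\mathsf R$ (all operators but $\mathsf X$ non-strict), interpreted in $\omega$-words over $A$. Let $n$ be the size of $\varphi$, that is, its number of distinct subformulas (a literal being its only subformula). Let $\mathcal A_\varphi$ be the following alternating automaton. It has one state $q_\psi$ for each subformula $\psi$ of $\varphi$, and transition conditions $\delta(q_a)=\{a\}$, $\delta(q_{\neg a})=A\setminus\{a\}$, $\delta(q_{\psi\vee\psi'})=\delta(q_\psi)\vee\delta(q_{\psi'})$, $\delta(q_{\psi\wedge\psi'})=\delta(q_\psi)\wedge\delta(q_{\psi'})$, $\delta(q_{\mathsf X\psi})=\bigcirc q_\psi$, $\delta(q_{\mathsf F\psi})=\delta(q_\psi)\vee\bigcirc q_{\mathsf F\psi}$, $\delta(q_{\mathsf G\psi})=\delta(q_\psi)\wedge\bigcirc q_{\mathsf G\psi}$, $\delta(q_{\psi\mathsf U\psi'})=\delta(q_{\psi'})\vee(\delta(q_\psi)\wedge\bigcirc q_{\psi\mathsf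 U\psi'})$, $\delta(q_{\psi\mathsf R\psi'})=\delta(q_{\psi'})\wedge(\delta(q_\psi)\vee\bigcirc q_{\psi\mathsf R\psi'})$. States of $\mathsf F$- and $\mathsf U$-formulas are non-recurring, states of $\mathsf G$- and $\mathsf R$-formulas are recurring, and each other state may be put on either side. A suffix $u[i,\omega)$ is accepted from $q$ if some run graph on $u$ contains the vertex $\langle i,q\rangle$ and on each of its infinite paths only recurring states occur infinitely often. For an alternating automaton $\mathcal A$ with finite state set $Q$, recurring states $R$ and non-recurring states $N=Q\setminus R$, let $\mathcal B(\mathcal A)$ be the following backward automaton; $S_q$ denotes the strongly connected component of $q$ in the transition graph of $\mathcal A$ (edges $q\to q'$ where $\bigcirc q'$ occurs in $\delta(q)$). Its states are the families $(v_q)_{q\in Q}$ with $v_q\in\{1,\dots,|S_q|,\infty\}$. Put $\mathrm{norm}(\infty)=\infty$, $\mathrm{norm}(k)=0$ for $k<\infty$, $\mathrm{neg}(0)=\infty$, $\mathrm{neg}(\infty)=0$. Given a letter $a$ and a state $v$, for $q\in N$ let $\tilde v_q$ be the value of $\delta(q)$ under: $B\mapsto 0$ if $a\in B$ and $\infty$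 otherwise; $\bigcirc q'\mapsto v_{q'}$ if $q'\in S_q$, $\mathrm{norm}(v_{q'})$ if $q'\in N\setminus S_q$, and $\mathrm{neg}(\mathrm{norm}(v_{q'}))$ if $q'\in R\setminus S_q$; $\vee\mapsto\min$; $\wedge\mapsto\max$. For $q\in R$ it is defined dually, exchanging $0$ and $\infty$ for $B$, $N$ and $R$, and $\min$ and $\max$. For a component $S$ the critical value $m_S$ is the least $m\ge 0$ that is not of the form $\tilde v_q$, $q\in S$. The transition function sends $(a,v)$ to $v'$ where, for $q\in S$, $v'_q=\tilde v_q$ if $m_S=0$ or $\tilde v_q>m_S$, and $v'_q=\tilde v_q+1$ otherwise. A run on $u$ is a sequence $r$ of states with $r(i)=\rho(u(i),r(i+1))$ for all $i$. For each component $S$ and $0<i\le|S|$ there is a Büchi set, consisting of the transitions $(v',a,v)$ such that $m_S=i$ or no $q\in S$ has a finite value $v'_q\ge i$; a run is final if for each Büchi set infinitely many of its transitions belong to it. The output function is $\lambda(v)=\{q\in N: v_q<\infty\}\cup\{q\in R: v_q=\infty\}$. Then: 1. $\mathcal A_\varphi$ is a very weak (hence weak) alternating automaton, and for every word $u$, position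 $i$ and subformula $\psi$, the suffix $u[i,\omega)$ is accepted from $q_\psi$ if and only if $\psi$ is true in $u[i,\omega)$. 2. $\mathcal B(\mathcal A_\varphi)$ has exactly $2^n$ states (in particular at most $2^{\ell}$, where $\ell$ is the number of occurrences of literals and operators in $\varphi$) and $n$ Büchi sets, and whether one of its transitions $(v',a,v)$ belongs to a given Büchi set depends only on $v'$, so its acceptance condition amounts to a state-based generalized Büchi condition. 3. $\mathcal B(\mathcal A_\varphi)$ is backward deterministic: every $\omega$-word over $A$ has exactly one final run $r$. For this run, $\lambda(r(i))$ is the set of states from which $\mathcal A_\varphi$ accepts $u[i,\omega)$, for every $i$. With initial states $\{v: q_\varphi\in\lambda(v)\}$, $\mathcal B(\mathcal A_\varphi)$ is equivalent to $\varphi$: $q_\varphi\in\lambda(r(0))$ if and only if $u$ satisfies $\varphi$. -/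

import Mathlib

open Filter

universe u v

/-! ## Weak alternating automata on infinite words

Words over `A` are functions `ℕ → A`. -/

/-- Transition conditions over a state set `Q` and an alphabet `A`: positive boolean
combinations of sets of letters `B ⊆ A` and of conditions `○ q`. -/
inductive TransCond (A : Type u) (Q : Type v) : Type (max u v)
  | letters (B : Set A) : TransCond A Q
  | next (q : Q) : TransCond A Q
  | or (τ₀ τ₁ : TransCond A Q) : TransCond A Q
  | and (τ₀ τ₁ : TransCond A Q) : TransCond A Q

namespace TransCond

variable {A : Type u} {Q : Type v}

/-- `τ.Subcond σ`: `τ` is a subformula of `σ` (possibly `σ` itself). -/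
def Subcond (τ : TransCond A Q) : TransCond A Q → Prop
  | letters B => τ = letters B
  | next q => τ = next q
  | or σ₀ σ₁ => τ = or σ₀ σ₁ ∨ τ.Subcond σ₀ ∨ τ.Subcond σ₁
  | and σ₀ σ₁ => τ = and σ₀ σ₁ ∨ τ.Subcond σ₀ ∨ τ.Subcond σ₁

end TransCond

/-- The data of an alternating automaton: a transition function and the set of recurring
states; the non-recurring states are the remaining ones. -/
structure AltAutomaton (A : Type u) (Q : Type v) where
  δ : Q → TransCond A Q
  recurring : Set Q

namespace AltAutomaton

variable {A : Type u} {Q : Type v} (𝒜 : AltAutomaton A Q)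

/-- Edges of the transition graph: `○ q'` occurs in `δ q`. -/
def Edge (q q' : Q) : Prop := (TransCond.next q').Subcond (𝒜.δ q)

/-- `q` and `q'` belong to the same strongly connected component of the transition graph. -/
def SameSCC (q q' : Q) : Prop :=
  Relation.ReflTransGen 𝒜.Edge q q' ∧ Relation.ReflTransGen 𝒜.Edge q' q

/-- In every strongly connected component, all states are recurring or all are non-recurring. -/
def IsWeak : Prop :=
  ∀ q q', 𝒜.SameSCC q q' → (q ∈ 𝒜.recurring ↔ q' ∈ 𝒜.recurring)

/-- The strongly connected components of the transition graph are singletons. -/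
def IsVeryWeak : Prop := ∀ q q', 𝒜.SameSCC q q' → q = q'

/-- Vertices `⟨i, τ⟩` of run graphs, where `τ` is a state or a transition condition. -/
abbrev Vertex (A : Type u) (Q : Type v) : Type (max u v) := ℕ × (Q ⊕ TransCond A Q)

/-- Run graphs of the automaton on the word `u`. -/
structure RunGraph (u : ℕ → A) where
  verts : Set (Vertex A Q)
  edge : Vertex A Q → Vertex A Q → Prop
  edge_mem : ∀ x y, edge x y → x ∈ verts ∧ y ∈ verts
  cond_mem : ∀ i τ, (i, Sum.inr τ) ∈ verts → ∃ q, τ.Subcond (𝒜.δ q)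
  edge_state : ∀ i q, (i, Sum.inl q) ∈ verts →
    ∀ y, edge (i, Sum.inl q) y ↔ y = (i, Sum.inr (𝒜.δ q))
  edge_next : ∀ i q, (i, Sum.inr (.next q)) ∈ verts →
    ∀ y, edge (i, Sum.inr (.next q)) y ↔ y = (i + 1, Sum.inl q)
  edge_or : ∀ i τ₀ τ₁, (i, Sum.inr (.or τ₀ τ₁)) ∈ verts →
    (∀ y, edge (i, Sum.inr (.or τ₀ τ₁)) y → y = (i, Sum.inr τ₀) ∨ y = (i, Sum.inr τ₁)) ∧
    ∃ y, edge (i, Sum.inr (.or τ₀ τ₁)) y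
  edge_and : ∀ i τ₀ τ₁, (i, Sum.inr (.and τ₀ τ₁)) ∈ verts →
    ∀ y, edge (i, Sum.inr (.and τ₀ τ₁)) y ↔ y = (i, Sum.inr τ₀) ∨ y = (i, Sum.inr τ₁)
  edge_letters : ∀ i B, (i, Sum.inr (.letters B)) ∈ verts →
    ∀ y, ¬ edge (i, Sum.inr (.letters B)) y
  letters_mem : ∀ i B, (i, Sum.inr (.letters B)) ∈ verts → u i ∈ B

/-- A run graph is final if on every infinite path all states that occur infinitely often are
recurring. -/
def RunGraph.IsFinal {𝒜 : AltAutomaton A Q} {u : ℕ → A} (G : 𝒜.RunGraph u) : Prop :=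
  ∀ p : ℕ → Vertex A Q, (∀ k, G.edge (p k) (p (k + 1))) →
    ∀ q, (∃ᶠ k in atTop, ∃ i, p k = (i, Sum.inl q)) → q ∈ 𝒜.recurring

/-- The suffix `u[i, ω)` is accepted from the state `q`. -/
def AcceptsFrom (u : ℕ → A) (i : ℕ) (q : Q) : Prop :=
  ∃ G : 𝒜.RunGraph u, G.IsFinal ∧ (i, Sum.inl q) ∈ G.verts

/-- The function `A^ω → (2^Q)^ω` computed by the automaton. -/
def computed (u : ℕ → A) (i : ℕ) : Set Q := {q | 𝒜.AcceptsFrom u i q}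

end AltAutomaton

/-! ## Backward deterministic generalized transition Büchi automata -/

/-- The data of a backward automaton with a generalized transition Büchi condition: finitely
many states, a backward transition function and finitely many Büchi sets of transitions
`(s, a, t)`, where `s` is the state before and `t` the state after the letter `a`. -/
structure BackwardAutomaton (A : Type u) where
  State : Type v
  finite_state : Finite State
  step : A → State → State
  Index : Type v
  finite_index : Finite Index
  buchi : Index → Set (State × A × State)

namespace BackwardAutomaton

variable {A : Type u} (ℬ : BackwardAutomaton.{u, v} A)

def IsRun (u : ℕ → A) (r : ℕ → ℬ.State) : Prop := ∀ i, r i = ℬ.step (u i) (r (i + 1))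

/-- A run is final if, for every Büchi set, infinitely many of its transitions are in it. -/
def IsFinalRun (u : ℕ → A) (r : ℕ → ℬ.State) : Prop :=
  ℬ.IsRun u r ∧ ∀ j, ∃ᶠ i in atTop, (r i, u i, r (i + 1)) ∈ ℬ.buchi j

/-- Every word has exactly one final run. -/
def IsBackwardDeterministic : Prop := ∀ u : ℕ → A, ∃! r, ℬ.IsFinalRun u r

/-- The Büchi sets are given by sets of states: whether a transition `(s, a, t)` is in the
`j`-th Büchi set depends only on `s`. -/
def IsStateBased : Prop :=
  ∃ F : ℬ.Index → Set ℬ.State, ∀ j a t,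
    (ℬ.step a t, a, t) ∈ ℬ.buchi j ↔ ℬ.step a t ∈ F j

variable {ℬ}

/-- The unique final run on `u`. -/
noncomputable def finalRun (h : ℬ.IsBackwardDeterministic) (u : ℕ → A) : ℕ → ℬ.State :=
  (h u).choose

/-- The function `A^ω → C^ω` computed by the automaton with respect to an output function. -/
noncomputable def computed {C : Type*} (h : ℬ.IsBackwardDeterministic) (out : ℬ.State → C)
    (u : ℕ → A) (i : ℕ) : C :=
  out (finalRun h u i)

/-- The language defined by the automaton with a set `I` of initial states. -/
def language (h : ℬ.IsBackwardDeterministic) (I : Set ℬ.State) : Set (ℕ → A) :=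
  {u | finalRun h u 0 ∈ I}

end BackwardAutomaton

/-! ## From weak alternating to backward deterministic automata -/

namespace AltAutomaton

/-- Normalization: `∞` goes to `∞`, finite values go to `0`. -/
noncomputable def normVal (x : ℕ∞) : ℕ∞ := open Classical in if x = ⊤ then ⊤ else 0

/-- Exchanges `0` and `∞`. -/
noncomputable def negVal (x : ℕ∞) : ℕ∞ := open Classical in if x = ⊤ then 0 else ⊤

variable {A : Type u} {Q : Type v} (𝒜 : AltAutomaton A Q)

open Classical in
/-- Value of a transition condition occurring at a non-recurring state `q`, when the letter `a`
is read and the states have the values `w` afterwards. Finite values mean acceptance. -/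
noncomputable def evalN (a : A) (w : Q → ℕ∞) (q : Q) : TransCond A Q → ℕ∞
  | .letters B => if a ∈ B then 0 else ⊤
  | .next q' =>
      if 𝒜.SameSCC q q' then w q'
      else if q' ∉ 𝒜.recurring then normVal (w q') else negVal (normVal (w q'))
  | .or τ₀ τ₁ => min (evalN a w q τ₀) (evalN a w q τ₁)
  | .and τ₀ τ₁ => max (evalN a w q τ₀) (evalN a w q τ₁)

open Classical in
/-- The dual value, for recurring states `q`. Finite values mean non-acceptance. -/
noncomputable def evalR (a : A) (w : Q → ℕ∞) (q : Q) : TransCond A Q → ℕ∞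
  | .letters B => if a ∈ B then ⊤ else 0
  | .next q' =>
      if 𝒜.SameSCC q q' then w q'
      else if q' ∈ 𝒜.recurring then normVal (w q') else negVal (normVal (w q'))
  | .or τ₀ τ₁ => max (evalR a w q τ₀) (evalR a w q τ₁)
  | .and τ₀ τ₁ => min (evalR a w q τ₀) (evalR a w q τ₁)

open Classical in
/-- The value of the state `q` before lifting. -/
noncomputable def rawVal (a : A) (w : Q → ℕ∞) (q : Q) : ℕ∞ :=
  if q ∈ 𝒜.recurring then 𝒜.evalR a w q (𝒜.δ q) else 𝒜.evalN a w q (𝒜.δ q)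

/-- The critical value: the least natural number that is not the value before lifting of a
state of `S`. -/
noncomputable def critical (a : A) (w : Q → ℕ∞) (S : Finset Q) : ℕ :=
  sInf {m : ℕ | ∀ q ∈ S, 𝒜.rawVal a w q ≠ m}

theorem critical_le (a : A) (w : Q → ℕ∞) (S : Finset Q) : 𝒜.critical a w S ≤ S.card := by
  classical
  by_contra! hlt
  have h : ∀ m ∈ Finset.range (S.card + 1),
      m ∈ S.image (fun q => (𝒜.rawVal a w q).toNat) := by
    intro m hm
    have hm' : m < 𝒜.critical a w S := by rw [Finset.mem_range] at hm; omega
    have := Nat.notMem_of_lt_sInf hm'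
    simp only [Set.mem_ofPred_eq, not_forall, not_not] at this
    obtain ⟨q, hq, e⟩ := this
    exact Finset.mem_image.2 ⟨q, hq, by simp [e]⟩
  have := (Finset.card_le_card h).trans Finset.card_image_le
  simp at this

theorem critical_spec (a : A) (w : Q → ℕ∞) (S : Finset Q) :
    ∀ q ∈ S, 𝒜.rawVal a w q ≠ 𝒜.critical a w S := by
  classical
  have : {m : ℕ | ∀ q ∈ S, 𝒜.rawVal a w q ≠ m}.Nonempty := by
    obtain ⟨m, hm⟩ := Infinite.exists_notMem_finset (S.image fun q => (𝒜.rawVal a w q).toNat)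
    refine ⟨m, fun q hq e => hm (Finset.mem_image.2 ⟨q, hq, by simp [e]⟩)⟩
  exact Nat.sInf_mem this

variable [Fintype Q]

open Classical in
/-- The strongly connected component of `q`. -/
noncomputable def scc (q : Q) : Finset Q := Finset.univ.filter fun q' => 𝒜.SameSCC q q'

open Classical in
/-- The value of the state `q` after lifting. -/
noncomputable def liftVal (a : A) (w : Q → ℕ∞) (q : Q) : ℕ∞ :=
  let m := 𝒜.critical a w (𝒜.scc q)
  if m = 0 then 𝒜.rawVal a w q
  else if (m : ℕ∞) < 𝒜.rawVal a w q then 𝒜.rawVal a w q else 𝒜.rawVal a w q + 1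

/-- Families `{w_q}` with `w_q ∈ {1, …, |S|, ∞}`, where `S` is the component of `q`. -/
def IsValuation (w : Q → ℕ∞) : Prop :=
  ∀ q, w q = ⊤ ∨ (1 ≤ w q ∧ w q ≤ (𝒜.scc q).card)

theorem mem_scc {q q' : Q} : q' ∈ 𝒜.scc q ↔ 𝒜.SameSCC q q' := by simp [scc]

theorem scc_eq_of_sameSCC {q q' : Q} (h : 𝒜.SameSCC q q') : 𝒜.scc q' = 𝒜.scc q := by
  ext x
  rw [mem_scc, mem_scc]
  exact ⟨fun k => ⟨h.1.trans k.1, k.2.trans h.2⟩, fun k => ⟨h.2.trans k.1, k.2.trans h.1⟩⟩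

theorem evalN_bound {w : Q → ℕ∞} (hw : 𝒜.IsValuation w) (a : A) (q : Q) (τ : TransCond A Q) :
    𝒜.evalN a w q τ = ⊤ ∨ 𝒜.evalN a w q τ ≤ (𝒜.scc q).card := by
  induction τ with
  | letters B => simp only [evalN]; split_ifs <;> simp
  | next q' =>
    simp only [evalN]
    split_ifs with h
    · rcases hw q' with h' | h'
      · exact Or.inl h'
      · rw [𝒜.scc_eq_of_sameSCC h] at h'; exact Or.inr h'.2
    all_goals simp only [normVal, negVal]; split_ifs <;> simp
  | or τ₀ τ₁ h₀ h₁ =>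
    simp only [evalN]
    rcases min_choice (𝒜.evalN a w q τ₀) (𝒜.evalN a w q τ₁) with h | h <;> rw [h] <;> assumption
  | and τ₀ τ₁ h₀ h₁ =>
    simp only [evalN]
    rcases max_choice (𝒜.evalN a w q τ₀) (𝒜.evalN a w q τ₁) with h | h <;> rw [h] <;> assumption

theorem evalR_bound {w : Q → ℕ∞} (hw : 𝒜.IsValuation w) (a : A) (q : Q) (τ : TransCond A Q) :
    𝒜.evalR a w q τ = ⊤ ∨ 𝒜.evalR a w q τ ≤ (𝒜.scc q).card := by
  induction τ with
  | letters B => simp only [evalR]; split_ifs <;> simp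
  | next q' =>
    simp only [evalR]
    split_ifs with h
    · rcases hw q' with h' | h'
      · exact Or.inl h'
      · rw [𝒜.scc_eq_of_sameSCC h] at h'; exact Or.inr h'.2
    all_goals simp only [normVal, negVal]; split_ifs <;> simp
  | or τ₀ τ₁ h₀ h₁ =>
    simp only [evalR]
    rcases max_choice (𝒜.evalR a w q τ₀) (𝒜.evalR a w q τ₁) with h | h <;> rw [h] <;> assumption
  | and τ₀ τ₁ h₀ h₁ =>
    simp only [evalR]
    rcases min_choice (𝒜.evalR a w q τ₀) (𝒜.evalR a w q τ₁) with h | h <;> rw [h] <;> assumption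

theorem rawVal_bound {w : Q → ℕ∞} (hw : 𝒜.IsValuation w) (a : A) (q : Q) :
    𝒜.rawVal a w q = ⊤ ∨ 𝒜.rawVal a w q ≤ (𝒜.scc q).card := by
  unfold rawVal
  split_ifs
  · exact 𝒜.evalR_bound hw a q _
  · exact 𝒜.evalN_bound hw a q _

theorem isValuation_liftVal {w : Q → ℕ∞} (hw : 𝒜.IsValuation w) (a : A) :
    𝒜.IsValuation (𝒜.liftVal a w) := by
  intro q
  have hq : q ∈ 𝒜.scc q := 𝒜.mem_scc.2 ⟨.refl, .refl⟩
  have hspec := 𝒜.critical_spec a w (𝒜.scc q) q hq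
  have hle := 𝒜.critical_le a w (𝒜.scc q)
  have hb := 𝒜.rawVal_bound hw a q
  simp only [liftVal]
  generalize 𝒜.rawVal a w q = x at *
  generalize 𝒜.critical a w (𝒜.scc q) = m at *
  induction x using ENat.recTopCoe with
  | top => left; split_ifs <;> simp
  | coe x =>
    right
    have hb' : x ≤ (𝒜.scc q).card := by simpa using hb
    have hspec' : x ≠ m := by simpa using hspec
    split_ifs with h1 h2
    · refine ⟨?_, by exact_mod_cast hb'⟩
      have : 1 ≤ x := by omega
      exact_mod_cast this
    · have h3 : m < x := by exact_mod_cast h2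
      refine ⟨?_, by exact_mod_cast hb'⟩
      have : 1 ≤ x := by omega
      exact_mod_cast this
    · have h3 : ¬ m < x := by exact_mod_cast h2
      have h4 : x + 1 ≤ (𝒜.scc q).card := by omega
      have h5 : 1 ≤ x + 1 := by omega
      exact ⟨by exact_mod_cast h5, by exact_mod_cast h4⟩

theorem finite_valuation : Finite {w : Q → ℕ∞ // 𝒜.IsValuation w} := by
  have : (Set.pi Set.univ fun q : Q => insert (⊤ : ℕ∞) (Set.Iic ((𝒜.scc q).card : ℕ∞))).Finite := by
    refine Set.Finite.pi fun q => Set.Finite.insert _ ?_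
    refine ((Set.finite_Iic (𝒜.scc q).card).image (fun k : ℕ => (k : ℕ∞))).subset ?_
    intro x hx
    have hx' : x ≤ ((𝒜.scc q).card : ℕ∞) := hx
    obtain ⟨k, rfl⟩ := ENat.ne_top_iff_exists.1 (ne_top_of_le_ne_top (ENat.natCast_ne_top _) hx')
    exact ⟨k, by simpa using hx', rfl⟩
  refine Set.Finite.to_subtype (s := {w | 𝒜.IsValuation w}) (this.subset ?_)
  intro w hw q _
  have hw' : 𝒜.IsValuation w := hw
  rcases hw' q with h | h
  · exact Or.inl h
  · exact Or.inr h.2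

/-- The backward automaton constructed from an alternating automaton. For every strongly
connected component `S` and every `i` with `0 < i ≤ |S|` (here `i = j.2 + 1`), there is a Büchi
set, consisting of all transitions `(w', a, w)` for which `i` is the critical value with respect
to `S`, or for which no state of `S` has a finite value `≥ i` in `w'`. -/
noncomputable def toBackward : BackwardAutomaton.{u, v} A where
  State := {w : Q → ℕ∞ // 𝒜.IsValuation w}
  finite_state := 𝒜.finite_valuation
  step a w := ⟨𝒜.liftVal a w.1, 𝒜.isValuation_liftVal w.2 a⟩
  Index := Σ S : {S : Finset Q // ∃ q, S = 𝒜.scc q}, Fin S.1.card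
  finite_index := inferInstance
  buchi j := {t | t.1.1 = 𝒜.liftVal t.2.1 t.2.2.1 ∧
    (𝒜.critical t.2.1 t.2.2.1 j.1.1 = j.2.1 + 1 ∨
      ¬ ∃ q ∈ j.1.1, t.1.1 q ≠ ⊤ ∧ ((j.2.1 + 1 : ℕ) : ℕ∞) ≤ t.1.1 q)}

/-- The output function: the set of states that are interpreted as accepting. -/
def output (w : 𝒜.toBackward.State) : Set Q :=
  {q | q ∉ 𝒜.recurring ∧ w.1 q < ⊤} ∪ {q | q ∈ 𝒜.recurring ∧ w.1 q = ⊤}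

end AltAutomaton

/-! ## Linear-time temporal logic -/

/-- LTL formulas in negation normal form over the alphabet `A`. -/
inductive LTL (A : Type u) : Type u
  | letter (a : A) : LTL A
  | negLetter (a : A) : LTL A
  | or (ψ ψ' : LTL A) : LTL A
  | and (ψ ψ' : LTL A) : LTL A
  | next (ψ : LTL A) : LTL A
  | eventually (ψ : LTL A) : LTL A
  | always (ψ : LTL A) : LTL A
  | untl (ψ ψ' : LTL A) : LTL A
  | release (ψ ψ' : LTL A) : LTL A

namespace LTL

variable {A : Type u}

/-- `φ.HoldsAt u i`: the formula `φ` is true in the suffix `u[i, ω)`. -/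
def HoldsAt (u : ℕ → A) : LTL A → ℕ → Prop
  | letter a, i => u i = a
  | negLetter a, i => u i ≠ a
  | or ψ ψ', i => HoldsAt u ψ i ∨ HoldsAt u ψ' i
  | and ψ ψ', i => HoldsAt u ψ i ∧ HoldsAt u ψ' i
  | next ψ, i => HoldsAt u ψ (i + 1)
  | eventually ψ, i => ∃ j, i ≤ j ∧ HoldsAt u ψ j
  | always ψ, i => ∀ j, i ≤ j → HoldsAt u ψ j
  | untl ψ ψ', i => ∃ j, i ≤ j ∧ HoldsAt u ψ' j ∧ ∀ k, i ≤ k → k < j → HoldsAt u ψ k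
  | release ψ ψ', i => ∀ j, i ≤ j → HoldsAt u ψ' j ∨ ∃ k, i ≤ k ∧ k < j ∧ HoldsAt u ψ k

/-- The language of a formula: the words in which it is true. -/
def language (φ : LTL A) : Set (ℕ → A) := {u | HoldsAt u φ 0}

open Classical in
/-- The set of subformulas; a literal `a` or `¬ a` is its only subformula. -/
noncomputable def subformulas : LTL A → Finset (LTL A)
  | letter a => {letter a}
  | negLetter a => {negLetter a}
  | or ψ ψ' => insert (or ψ ψ') (subformulas ψ ∪ subformulas ψ')
  | and ψ ψ' => insert (and ψ ψ') (subformulas ψ ∪ subformulas ψ')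
  | next ψ => insert (next ψ) (subformulas ψ)
  | eventually ψ => insert (eventually ψ) (subformulas ψ)
  | always ψ => insert (always ψ) (subformulas ψ)
  | untl ψ ψ' => insert (untl ψ ψ') (subformulas ψ ∪ subformulas ψ')
  | release ψ ψ' => insert (release ψ ψ') (subformulas ψ ∪ subformulas ψ')

/-- The size of a formula, as its number of distinct subformulas. -/
noncomputable def size (φ : LTL A) : ℕ := φ.subformulas.card

/-- The length of a formula, as the number of occurrences of literals and operators. -/
def length : LTL A → ℕ
  | letter _ => 1
  | negLetter _ => 1
  | or ψ ψ' => length ψ + length ψ' + 1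
  | and ψ ψ' => length ψ + length ψ' + 1
  | next ψ => length ψ + 1
  | eventually ψ => length ψ + 1
  | always ψ => length ψ + 1
  | untl ψ ψ' => length ψ + length ψ' + 1
  | release ψ ψ' => length ψ + length ψ' + 1

theorem self_mem_subformulas (φ : LTL A) : φ ∈ φ.subformulas := by
  cases φ <;> simp [subformulas]

theorem subformulas_trans {ψ χ φ : LTL A} (h : ψ ∈ χ.subformulas) (h' : χ ∈ φ.subformulas) :
    ψ ∈ φ.subformulas := by
  induction φ with
  | letter a => simp only [subformulas, Finset.mem_singleton] at h'; exact h' ▸ h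
  | negLetter a => simp only [subformulas, Finset.mem_singleton] at h'; exact h' ▸ h
  | or φ₀ φ₁ h₀ h₁ | and φ₀ φ₁ h₀ h₁ | untl φ₀ φ₁ h₀ h₁ | release φ₀ φ₁ h₀ h₁ =>
    simp only [subformulas, Finset.mem_insert, Finset.mem_union] at h'
    rcases h' with rfl | h' | h'
    · exact h
    · simp [subformulas, h₀ h']
    · simp [subformulas, h₁ h']
  | next φ₀ h₀ | eventually φ₀ h₀ | always φ₀ h₀ =>
    simp only [subformulas, Finset.mem_insert] at h'
    rcases h' with rfl | h'
    · exact h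
    · simp [subformulas, h₀ h']

/-- The states `q_ψ` of the alternating automaton, one for each subformula `ψ` of `φ`. -/
abbrev Sub (φ : LTL A) : Type u := {ψ : LTL A // ψ ∈ φ.subformulas}

/-- The state `q_φ`. -/
def top (φ : LTL A) : φ.Sub := ⟨φ, φ.self_mem_subformulas⟩

section

variable {φ : LTL A}

theorem sub_or {ψ ψ' : LTL A} (h : or ψ ψ' ∈ φ.subformulas) :
    ψ ∈ φ.subformulas ∧ ψ' ∈ φ.subformulas :=
  ⟨subformulas_trans (by simp [subformulas, self_mem_subformulas]) h,
    subformulas_trans (by simp [subformulas, self_mem_subformulas]) h⟩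

theorem sub_and {ψ ψ' : LTL A} (h : and ψ ψ' ∈ φ.subformulas) :
    ψ ∈ φ.subformulas ∧ ψ' ∈ φ.subformulas :=
  ⟨subformulas_trans (by simp [subformulas, self_mem_subformulas]) h,
    subformulas_trans (by simp [subformulas, self_mem_subformulas]) h⟩

theorem sub_next {ψ : LTL A} (h : next ψ ∈ φ.subformulas) : ψ ∈ φ.subformulas :=
  subformulas_trans (by simp [subformulas, self_mem_subformulas]) h

theorem sub_eventually {ψ : LTL A} (h : eventually ψ ∈ φ.subformulas) : ψ ∈ φ.subformulas :=
  subformulas_trans (by simp [subformulas, self_mem_subformulas]) h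

theorem sub_always {ψ : LTL A} (h : always ψ ∈ φ.subformulas) : ψ ∈ φ.subformulas :=
  subformulas_trans (by simp [subformulas, self_mem_subformulas]) h

theorem sub_untl {ψ ψ' : LTL A} (h : untl ψ ψ' ∈ φ.subformulas) :
    ψ ∈ φ.subformulas ∧ ψ' ∈ φ.subformulas :=
  ⟨subformulas_trans (by simp [subformulas, self_mem_subformulas]) h,
    subformulas_trans (by simp [subformulas, self_mem_subformulas]) h⟩

theorem sub_release {ψ ψ' : LTL A} (h : release ψ ψ' ∈ φ.subformulas) :
    ψ ∈ φ.subformulas ∧ ψ' ∈ φ.subformulas :=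
  ⟨subformulas_trans (by simp [subformulas, self_mem_subformulas]) h,
    subformulas_trans (by simp [subformulas, self_mem_subformulas]) h⟩

/-- The transition condition of the state `q_ψ`. -/
def trans : (ψ : LTL A) → ψ ∈ φ.subformulas → TransCond A φ.Sub
  | letter a, _ => .letters {a}
  | negLetter a, _ => .letters {a}ᶜ
  | or ψ ψ', h => .or (trans ψ (sub_or h).1) (trans ψ' (sub_or h).2)
  | and ψ ψ', h => .and (trans ψ (sub_and h).1) (trans ψ' (sub_and h).2)
  | next ψ, h => .next ⟨ψ, sub_next h⟩
  | eventually ψ, h => .or (trans ψ (sub_eventually h)) (.next ⟨eventually ψ, h⟩)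
  | always ψ, h => .and (trans ψ (sub_always h)) (.next ⟨always ψ, h⟩)
  | untl ψ ψ', h =>
      .or (trans ψ' (sub_untl h).2) (.and (trans ψ (sub_untl h).1) (.next ⟨untl ψ ψ', h⟩))
  | release ψ ψ', h =>
      .and (trans ψ' (sub_release h).2)
        (.or (trans ψ (sub_release h).1) (.next ⟨release ψ ψ', h⟩))

end

/-- States of eventually and until formulas are non-recurring, states of always and release
formulas are recurring; the other states may be put on either side. -/
def IsRecurringSet (φ : LTL A) (R : Set φ.Sub) : Prop :=
  ∀ q : φ.Sub,
    (∀ ψ, q.1 = eventually ψ → q ∉ R) ∧ (∀ ψ ψ', q.1 = untl ψ ψ' → q ∉ R) ∧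
    (∀ ψ, q.1 = always ψ → q ∈ R) ∧ (∀ ψ ψ', q.1 = release ψ ψ' → q ∈ R)

/-- The alternating automaton of the formula `φ`, with set `R` of recurring states. -/
def toAlt (φ : LTL A) (R : Set φ.Sub) : AltAutomaton A φ.Sub where
  δ q := trans q.1 q.2
  recurring := R

end LTL

/-! An edge of the transition graph leads from a formula to one of its subformulas, and a proper
subformula is strictly shorter, so every component is a singleton. Hence a value is `1` or `⊤`, a
state of the backward automaton is the same thing as a set of subformulas (those labelled
accepting), and there is one Büchi set per subformula.

In this reading a transition says only that the labels at a position are those obtained by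
evaluating the transition conditions with the labels at the next position
(`mem_acceptedStates_liftVal`). A transition misses the Büchi set of `q` exactly when the value of
`q` before lifting is `1`. This value can only come from the self-loop of `q`, so it never arises
for literals, `∨`, `∧` and `X`. For the other operators it means that `Fψ` or `ψUψ'` is labelled
true while `ψ` resp. `ψ'` is not, or that `Gψ` or `ψRψ'` is labelled false while `ψ` resp. `ψ'` is
labelled true (`rawVal_eq_top_or_zero_iff`). This depends on the labels before the letter alone.

The labelling by truth is consistent, by the expansion laws, and fair infinitely often. Conversely,
induction on formulas shows that every consistent labelling that is fair infinitely often is the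
labelling by truth (`mem_iff_holdsAt_of_frequently_fair`). This gives existence and uniqueness of
the final run.

For the alternating automaton, true vertices form a final run graph (`isFinal_canonicalRunGraph`).
In any final run graph the conditions that occur are true, because a false `F` or `U` formula would
force the graph around its non-recurring self-loop forever (`holdsAt_of_mem_verts`). -/

/-! ### Truth of transition conditions -/

namespace TransCond

variable {A : Type u} {Q : Type v}

/-- Truth of a transition condition when the letter `a` is read and `S` is the set of states
that accept afterwards. -/
def Sat (a : A) (S : Set Q) : TransCond A Q → Prop
  | letters B => a ∈ B
  | next q => q ∈ S
  | or τ₀ τ₁ => τ₀.Sat a S ∨ τ₁.Sat a S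
  | and τ₀ τ₁ => τ₀.Sat a S ∧ τ₁.Sat a S

theorem Subcond.refl (τ : TransCond A Q) : τ.Subcond τ := by
  cases τ <;> simp [Subcond]

theorem Subcond.trans {ρ σ τ : TransCond A Q} (h : ρ.Subcond σ) (h' : σ.Subcond τ) :
    ρ.Subcond τ := by
  induction τ with
  | letters B => simp only [Subcond] at h'; exact h' ▸ h
  | next q => simp only [Subcond] at h'; exact h' ▸ h
  | or τ₀ τ₁ h₀ h₁ | and τ₀ τ₁ h₀ h₁ =>
    simp only [Subcond] at h'
    rcases h' with rfl | h' | h'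
    · exact h
    · exact Or.inr (Or.inl (h₀ h'))
    · exact Or.inr (Or.inr (h₁ h'))

end TransCond

/-! ### Values as acceptance in weak and very weak automata -/

namespace AltAutomaton

variable {A : Type u} {Q : Type v} {𝒜 : AltAutomaton A Q}

theorem normVal_eq_top_iff {x : ℕ∞} : normVal x = ⊤ ↔ x = ⊤ := by
  simp only [normVal]; split_ifs with h <;> simp [h]

theorem negVal_eq_top_iff {x : ℕ∞} : negVal x = ⊤ ↔ x ≠ ⊤ := by
  simp only [negVal]; split_ifs with h <;> simp [h]

theorem normVal_eq_top_or_zero (x : ℕ∞) : normVal x = ⊤ ∨ normVal x = 0 := by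
  simp only [normVal]; split_ifs <;> simp

theorem negVal_eq_top_or_zero (x : ℕ∞) : negVal x = ⊤ ∨ negVal x = 0 := by
  simp only [negVal]; split_ifs <;> simp

/-- The states that are interpreted as accepting in a family of values. -/
def acceptedStates (𝒜 : AltAutomaton A Q) (w : Q → ℕ∞) : Set Q :=
  {q | q ∉ 𝒜.recurring ∧ w q < ⊤} ∪ {q | q ∈ 𝒜.recurring ∧ w q = ⊤}

theorem mem_acceptedStates_of_mem {w : Q → ℕ∞} {q : Q} (h : q ∈ 𝒜.recurring) :
    q ∈ 𝒜.acceptedStates w ↔ w q = ⊤ := by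
  simp [acceptedStates, h]

theorem mem_acceptedStates_of_notMem {w : Q → ℕ∞} {q : Q} (h : q ∉ 𝒜.recurring) :
    q ∈ 𝒜.acceptedStates w ↔ w q ≠ ⊤ := by
  simp [acceptedStates, h, lt_top_iff_ne_top]

/-- Within the component of `q`, weakness makes `q'` non-recurring like `q`, so its value is read
with the same meaning; outside, `negVal` corrects the meaning for recurring states. The condition
`τ` is arbitrary, so that parts of `δ q` can be evaluated at `q`. -/
theorem evalN_ne_top_iff (hA : 𝒜.IsWeak) {a : A} {w : Q → ℕ∞} {q : Q} (hq : q ∉ 𝒜.recurring)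
    (τ : TransCond A Q) : 𝒜.evalN a w q τ ≠ ⊤ ↔ τ.Sat a (𝒜.acceptedStates w) := by
  induction τ with
  | letters B => by_cases h : a ∈ B <;> simp [evalN, TransCond.Sat, h]
  | next q' =>
    simp only [evalN, TransCond.Sat]
    split_ifs with h h'
    · rw [mem_acceptedStates_of_notMem (fun hh => hq ((hA q q' h).2 hh))]
    · rw [mem_acceptedStates_of_mem h', ne_eq, negVal_eq_top_iff, not_not, normVal_eq_top_iff]
    · rw [mem_acceptedStates_of_notMem h', ne_eq, normVal_eq_top_iff]
  | or τ₀ τ₁ h₀ h₁ =>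
    simp only [evalN, TransCond.Sat, ← h₀, ← h₁, ne_eq, min_eq_top]; tauto
  | and τ₀ τ₁ h₀ h₁ =>
    simp only [evalN, TransCond.Sat, ← h₀, ← h₁, ne_eq, max_eq_top]; tauto

theorem evalR_eq_top_iff (hA : 𝒜.IsWeak) {a : A} {w : Q → ℕ∞} {q : Q} (hq : q ∈ 𝒜.recurring)
    (τ : TransCond A Q) : 𝒜.evalR a w q τ = ⊤ ↔ τ.Sat a (𝒜.acceptedStates w) := by
  induction τ with
  | letters B => by_cases h : a ∈ B <;> simp [evalR, TransCond.Sat, h]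
  | next q' =>
    simp only [evalR, TransCond.Sat]
    split_ifs with h h'
    · rw [mem_acceptedStates_of_mem ((hA q q' h).1 hq)]
    · rw [mem_acceptedStates_of_mem h', normVal_eq_top_iff]
    · rw [mem_acceptedStates_of_notMem h', negVal_eq_top_iff, ne_eq, normVal_eq_top_iff]
  | or τ₀ τ₁ h₀ h₁ => simp only [evalR, TransCond.Sat, ← h₀, ← h₁, max_eq_top]
  | and τ₀ τ₁ h₀ h₁ => simp only [evalR, TransCond.Sat, ← h₀, ← h₁, min_eq_top]

/-- Letters, `normVal` and `negVal` produce only `0` and `⊤`. Any other value enters through a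
successor in the component of `q`, which is `q` itself. -/
theorem evalN_eq_top_or_zero (hA : 𝒜.IsVeryWeak) {a : A} {w : Q → ℕ∞} {q : Q}
    {τ : TransCond A Q} (hτ : ¬ (TransCond.next q).Subcond τ) :
    𝒜.evalN a w q τ = ⊤ ∨ 𝒜.evalN a w q τ = 0 := by
  induction τ with
  | letters B => simp only [evalN]; split_ifs <;> simp
  | next q' =>
    simp only [evalN]
    split_ifs with h h'
    · exact absurd (by simp [TransCond.Subcond, hA q q' h]) hτ
    · exact negVal_eq_top_or_zero _
    · exact normVal_eq_top_or_zero _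
  | or τ₀ τ₁ h₀ h₁ | and τ₀ τ₁ h₀ h₁ =>
    simp only [TransCond.Subcond, not_or] at hτ
    rcases h₀ hτ.2.1 with h | h <;> rcases h₁ hτ.2.2 with h' | h' <;> simp [evalN, h, h']

theorem evalR_eq_top_or_zero (hA : 𝒜.IsVeryWeak) {a : A} {w : Q → ℕ∞} {q : Q}
    {τ : TransCond A Q} (hτ : ¬ (TransCond.next q).Subcond τ) :
    𝒜.evalR a w q τ = ⊤ ∨ 𝒜.evalR a w q τ = 0 := by
  induction τ with
  | letters B => simp only [evalR]; split_ifs <;> simp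
  | next q' =>
    simp only [evalR]
    split_ifs with h h'
    · exact absurd (by simp [TransCond.Subcond, hA q q' h]) hτ
    · exact normVal_eq_top_or_zero _
    · exact negVal_eq_top_or_zero _
  | or τ₀ τ₁ h₀ h₁ | and τ₀ τ₁ h₀ h₁ =>
    simp only [TransCond.Subcond, not_or] at hτ
    rcases h₀ hτ.2.1 with h | h <;> rcases h₁ hτ.2.2 with h' | h' <;> simp [evalR, h, h']

theorem rawVal_eq_top_or_zero (hA : 𝒜.IsVeryWeak) {a : A} {w : Q → ℕ∞} {q : Q}
    (h : ¬ 𝒜.Edge q q) : 𝒜.rawVal a w q = ⊤ ∨ 𝒜.rawVal a w q = 0 := by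
  unfold rawVal
  split_ifs
  · exact evalR_eq_top_or_zero hA h
  · exact evalN_eq_top_or_zero hA h

theorem IsVeryWeak.isWeak (hA : 𝒜.IsVeryWeak) : 𝒜.IsWeak := fun q q' h => by rw [hA q q' h]

variable [Fintype Q]

theorem liftVal_eq_top_iff {a : A} {w : Q → ℕ∞} {q : Q} :
    𝒜.liftVal a w q = ⊤ ↔ 𝒜.rawVal a w q = ⊤ := by
  simp only [liftVal]; split_ifs <;> simp

/-- Lifting preserves finiteness, so on the level of labels the transition function is just
evaluation of `δ`. -/
theorem mem_acceptedStates_liftVal (hA : 𝒜.IsWeak) {a : A} {w : Q → ℕ∞} {q : Q} :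
    q ∈ 𝒜.acceptedStates (𝒜.liftVal a w) ↔ (𝒜.δ q).Sat a (𝒜.acceptedStates w) := by
  by_cases h : q ∈ 𝒜.recurring
  · rw [mem_acceptedStates_of_mem h, liftVal_eq_top_iff, rawVal, if_pos h, evalR_eq_top_iff hA h]
  · rw [mem_acceptedStates_of_notMem h, ne_eq, liftVal_eq_top_iff, rawVal, if_neg h, ← ne_eq,
      evalN_ne_top_iff hA h]

theorem IsVeryWeak.scc_eq (hA : 𝒜.IsVeryWeak) (q : Q) : 𝒜.scc q = {q} := by
  ext q'
  rw [mem_scc, Finset.mem_singleton]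
  exact ⟨fun h => (hA _ _ h).symm, fun h => h ▸ ⟨.refl, .refl⟩⟩

theorem IsVeryWeak.eq_top_or_one (hA : 𝒜.IsVeryWeak) {w : Q → ℕ∞} (hw : 𝒜.IsValuation w) (q : Q) :
    w q = ⊤ ∨ w q = 1 := by
  refine (hw q).imp_right fun h => le_antisymm ?_ h.1
  simpa [hA.scc_eq] using h.2

theorem IsVeryWeak.eq_of_acceptedStates_eq (hA : 𝒜.IsVeryWeak) {v w : Q → ℕ∞}
    (hv : 𝒜.IsValuation v) (hw : 𝒜.IsValuation w)
    (h : 𝒜.acceptedStates v = 𝒜.acceptedStates w) : v = w := by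
  funext q
  have hq := Set.ext_iff.1 h q
  by_cases hR : q ∈ 𝒜.recurring
  · rw [mem_acceptedStates_of_mem hR, mem_acceptedStates_of_mem hR] at hq
    rcases hA.eq_top_or_one hv q with h | h <;> rcases hA.eq_top_or_one hw q with h' | h' <;>
      simp_all
  · rw [mem_acceptedStates_of_notMem hR, mem_acceptedStates_of_notMem hR] at hq
    rcases hA.eq_top_or_one hv q with h | h <;> rcases hA.eq_top_or_one hw q with h' | h' <;>
      simp_all

open Classical in
theorem IsVeryWeak.exists_acceptedStates_eq (hA : 𝒜.IsVeryWeak) (S : Set Q) :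
    ∃ w, 𝒜.IsValuation w ∧ 𝒜.acceptedStates w = S := by
  -- The value `⊤` means acceptance at recurring states and rejection at the others, so it is
  -- assigned when membership in the two sets agrees.
  refine ⟨fun q => if (q ∈ 𝒜.recurring ↔ q ∈ S) then ⊤ else 1, fun q => ?_, ?_⟩
  · by_cases h : q ∈ 𝒜.recurring ↔ q ∈ S <;> simp [h, hA.scc_eq]
  · ext q
    by_cases hR : q ∈ 𝒜.recurring
    · rw [mem_acceptedStates_of_mem hR]
      by_cases hS : q ∈ S <;> simp [hR, hS]
    · rw [mem_acceptedStates_of_notMem hR]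
      by_cases hS : q ∈ S <;> simp [hR, hS]

theorem IsVeryWeak.card_state (hA : 𝒜.IsVeryWeak) :
    Nat.card 𝒜.toBackward.State = 2 ^ Fintype.card Q := by
  classical
  let f : 𝒜.toBackward.State → Set Q := fun w => 𝒜.acceptedStates w.1
  have hf : Function.Bijective f :=
    ⟨fun v w h => Subtype.ext (hA.eq_of_acceptedStates_eq v.2 w.2 h),
      fun S => (hA.exists_acceptedStates_eq S).elim fun w hw => ⟨⟨w, hw.1⟩, hw.2⟩⟩
  rw [Nat.card_congr (Equiv.ofBijective f hf), Nat.card_eq_fintype_card, Fintype.card_set]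

theorem IsVeryWeak.card_index (hA : 𝒜.IsVeryWeak) :
    Nat.card 𝒜.toBackward.Index = Fintype.card Q := by
  classical
  rw [← Nat.card_eq_fintype_card]
  symm
  have hpos (q : Q) : 0 < (𝒜.scc q).card := by simp [hA.scc_eq]
  refine Nat.card_congr (Equiv.ofBijective
    (fun q => (⟨⟨𝒜.scc q, q, rfl⟩, ⟨0, hpos q⟩⟩ : 𝒜.toBackward.Index)) ⟨fun p q h => ?_, ?_⟩)
  · have h' : 𝒜.scc p = 𝒜.scc q := congrArg (fun j : 𝒜.toBackward.Index => j.1.1) h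
    simpa [hA.scc_eq] using h'
  · rintro ⟨⟨S, q, rfl⟩, i⟩
    refine ⟨q, ?_⟩
    have hi : i = ⟨0, hpos q⟩ := by
      have := i.2
      ext
      simp only [hA.scc_eq, Finset.card_singleton] at this
      simpa using this
    rw [hi]

/-- With one state in the component, the critical value is `1` if the value before lifting is `0`,
and `0` otherwise. So the transition is missed exactly when the value before lifting is finite and
positive. -/
theorem IsVeryWeak.mem_buchi_iff (hA : 𝒜.IsVeryWeak) {j : 𝒜.toBackward.Index} {q : Q}
    (hq : q ∈ j.1.1) (a : A) (w : 𝒜.toBackward.State) :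
    (𝒜.toBackward.step a w, a, w) ∈ 𝒜.toBackward.buchi j ↔
      𝒜.rawVal a w.1 q = ⊤ ∨ 𝒜.rawVal a w.1 q = 0 := by
  obtain ⟨⟨S, p, rfl⟩, i, hi⟩ := j
  have hqp : q = p := by simpa [hA.scc_eq] using hq
  subst hqp
  have hi0 : i = 0 := by simpa [hA.scc_eq] using hi
  subst hi0
  have hspec := 𝒜.critical_spec a w.1 (𝒜.scc q) q hq
  have hle := 𝒜.critical_le a w.1 (𝒜.scc q)
  have hraw : 𝒜.rawVal a w.1 q ≠ 0 → 𝒜.critical a w.1 (𝒜.scc q) = 0 := fun h =>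
    Nat.sInf_eq_zero.2 (Or.inl (by simpa [hA.scc_eq] using h))
  have hlift := liftVal_eq_top_iff (𝒜 := 𝒜) (a := a) (w := w.1) (q := q)
  have h1 := hA.eq_top_or_one (𝒜.isValuation_liftVal w.2 a) q
  -- The index `0` stands for the Büchi set with `i = 1`, and having no finite value `≥ 1` means
  -- having the value `⊤`.
  have hmem : (𝒜.toBackward.step a w, a, w) ∈ 𝒜.toBackward.buchi ⟨⟨𝒜.scc q, q, rfl⟩, 0, hi⟩ ↔
      (𝒜.critical a w.1 (𝒜.scc q) = 1 ∨ 𝒜.liftVal a w.1 q = ⊤) := by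
    refine (and_iff_right_of_imp fun _ => rfl).trans (or_congr Iff.rfl ?_)
    have hval : (𝒜.toBackward.step a w).1 = 𝒜.liftVal a w.1 := rfl
    simp only [hA.scc_eq, Finset.mem_singleton, exists_eq_left, hval]
    rcases h1 with h | h <;> simp [h]
  rw [hmem, ← hlift, or_comm]
  refine or_congr Iff.rfl ⟨fun h => ?_, fun h => ?_⟩
  · by_contra h0
    rw [hraw h0] at h; exact absurd h (by simp)
  · rw [h] at hspec
    simp only [hA.scc_eq, Finset.card_singleton] at hle hspec ⊢
    have : 𝒜.critical a w.1 {q} ≠ 0 := fun e => hspec (by simp [e])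
    omega

end AltAutomaton

/-! ### Subformulas and very weakness -/

namespace LTL

variable {A : Type u} {φ : LTL A}

theorem eq_or_length_lt_of_mem_subformulas {ψ χ : LTL A} (h : ψ ∈ χ.subformulas) :
    ψ = χ ∨ ψ.length < χ.length := by
  induction χ with
  | letter a | negLetter a => exact Or.inl (by simpa [subformulas] using h)
  | or φ₀ φ₁ h₀ h₁ | and φ₀ φ₁ h₀ h₁ | untl φ₀ φ₁ h₀ h₁ | release φ₀ φ₁ h₀ h₁ =>
    simp only [subformulas, Finset.mem_insert, Finset.mem_union] at h
    simp only [length]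
    rcases h with h | h | h
    · exact Or.inl h
    · rcases h₀ h with rfl | h <;> right <;> omega
    · rcases h₁ h with rfl | h <;> right <;> omega
  | next φ₀ h₀ | eventually φ₀ h₀ | always φ₀ h₀ =>
    simp only [subformulas, Finset.mem_insert] at h
    simp only [length]
    rcases h with h | h
    · exact Or.inl h
    · rcases h₀ h with rfl | h <;> right <;> omega

theorem size_le_length (φ : LTL A) : φ.size ≤ φ.length := by
  classical
  unfold size
  induction φ with
  | letter a | negLetter a => simp [subformulas, length]
  | or φ₀ φ₁ h₀ h₁ | and φ₀ φ₁ h₀ h₁ | untl φ₀ φ₁ h₀ h₁ | release φ₀ φ₁ h₀ h₁ =>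
    simp only [subformulas, length]
    refine (Finset.card_insert_le _ _).trans ?_
    have := Finset.card_union_le φ₀.subformulas φ₁.subformulas
    omega
  | next φ₀ h₀ | eventually φ₀ h₀ | always φ₀ h₀ =>
    simp only [subformulas, length]
    refine (Finset.card_insert_le _ _).trans ?_
    omega

/-- This is the source of very weakness: unfolding `δ` meets `○` only at an `X` formula, where it
points to the operand, or at a temporal formula, where it points back to that formula. -/
theorem mem_subformulas_of_next_subcond_trans {q : φ.Sub} (ψ : LTL A) (h : ψ ∈ φ.subformulas)
    (hq : (TransCond.next q).Subcond (trans ψ h)) : q.1 ∈ ψ.subformulas := by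
  induction ψ with
  | letter a | negLetter a => simp [trans, TransCond.Subcond] at hq
  | or ψ₀ ψ₁ h₀ h₁ | and ψ₀ ψ₁ h₀ h₁ =>
    simp only [trans, TransCond.Subcond, reduceCtorEq, false_or] at hq
    simp only [subformulas, Finset.mem_insert, Finset.mem_union]
    rcases hq with hq | hq
    · exact Or.inr (Or.inl (h₀ _ hq))
    · exact Or.inr (Or.inr (h₁ _ hq))
  | next ψ₀ _ =>
    simp only [trans, TransCond.Subcond, TransCond.next.injEq] at hq
    simp [hq, subformulas, self_mem_subformulas]
  | eventually ψ₀ h₀ | always ψ₀ h₀ =>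
    simp only [trans, TransCond.Subcond, reduceCtorEq, false_or, TransCond.next.injEq] at hq
    simp only [subformulas, Finset.mem_insert]
    rcases hq with hq | hq
    · exact Or.inr (h₀ _ hq)
    · exact Or.inl (by rw [hq])
  | untl ψ₀ ψ₁ h₀ h₁ | release ψ₀ ψ₁ h₀ h₁ =>
    simp only [trans, TransCond.Subcond, reduceCtorEq, false_or, TransCond.next.injEq] at hq
    simp only [subformulas, Finset.mem_insert, Finset.mem_union]
    rcases hq with hq | hq | hq
    · exact Or.inr (Or.inr (h₁ _ hq))
    · exact Or.inr (Or.inl (h₀ _ hq))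
    · exact Or.inl (by rw [hq])

theorem length_le_of_next_subcond_trans {q : φ.Sub} {ψ : LTL A} {h : ψ ∈ φ.subformulas}
    (hq : (TransCond.next q).Subcond (trans ψ h)) : q.1.length ≤ ψ.length := by
  rcases eq_or_length_lt_of_mem_subformulas (mem_subformulas_of_next_subcond_trans ψ h hq) with
    e | e
  · rw [e]
  · exact e.le

theorem not_next_subcond_trans {q : φ.Sub} {ψ : LTL A} {h : ψ ∈ φ.subformulas}
    (hlt : ψ.length < q.1.length) : ¬ (TransCond.next q).Subcond (trans ψ h) :=
  fun hq => (length_le_of_next_subcond_trans hq).not_gt hlt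

theorem mem_subformulas_of_reflTransGen {R : Set φ.Sub} {q q' : φ.Sub}
    (h : Relation.ReflTransGen (φ.toAlt R).Edge q q') : q'.1 ∈ q.1.subformulas := by
  induction h with
  | refl => exact self_mem_subformulas _
  | tail _ h ih => exact subformulas_trans (mem_subformulas_of_next_subcond_trans _ _ h) ih

/-- Two formulas on a common cycle are subformulas of each other; if they differed, each would be
shorter than the other. -/
theorem isVeryWeak_toAlt (R : Set φ.Sub) : (φ.toAlt R).IsVeryWeak := by
  intro q q' h
  rcases eq_or_length_lt_of_mem_subformulas (mem_subformulas_of_reflTransGen h.1) with e | e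
  · exact Subtype.ext e.symm
  · rcases eq_or_length_lt_of_mem_subformulas (mem_subformulas_of_reflTransGen h.2) with e' | e'
    · exact Subtype.ext e'
    · omega

/-! ### Expansion laws -/

theorem holdsAt_eventually_iff {u : ℕ → A} {ψ : LTL A} {i : ℕ} :
    HoldsAt u (eventually ψ) i ↔ HoldsAt u ψ i ∨ HoldsAt u (eventually ψ) (i + 1) := by
  simp only [HoldsAt]
  constructor
  · rintro ⟨j, hj, h⟩
    rcases hj.eq_or_lt with rfl | hj
    · exact Or.inl h
    · exact Or.inr ⟨j, hj, h⟩
  · rintro (h | ⟨j, hj, h⟩)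
    · exact ⟨i, le_rfl, h⟩
    · exact ⟨j, by omega, h⟩

theorem holdsAt_always_iff {u : ℕ → A} {ψ : LTL A} {i : ℕ} :
    HoldsAt u (always ψ) i ↔ HoldsAt u ψ i ∧ HoldsAt u (always ψ) (i + 1) := by
  simp only [HoldsAt]
  refine ⟨fun h => ⟨h i le_rfl, fun j hj => h j (by omega)⟩, fun h j hj => ?_⟩
  rcases hj.eq_or_lt with rfl | hj
  · exact h.1
  · exact h.2 j hj

theorem holdsAt_untl_iff {u : ℕ → A} {ψ ψ' : LTL A} {i : ℕ} :
    HoldsAt u (untl ψ ψ') i ↔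
      HoldsAt u ψ' i ∨ (HoldsAt u ψ i ∧ HoldsAt u (untl ψ ψ') (i + 1)) := by
  simp only [HoldsAt]
  constructor
  · rintro ⟨j, hj, h, h'⟩
    rcases hj.eq_or_lt with rfl | hj
    · exact Or.inl h
    · exact Or.inr ⟨h' i le_rfl hj, j, hj, h, fun k hk => h' k (by omega)⟩
  · rintro (h | ⟨h₀, j, hj, h, h'⟩)
    · exact ⟨i, le_rfl, h, fun k _ _ => by omega⟩
    · refine ⟨j, by omega, h, fun k hk hkj => ?_⟩
      rcases hk.eq_or_lt with rfl | hk
      · exact h₀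
      · exact h' k hk hkj

theorem holdsAt_release_iff {u : ℕ → A} {ψ ψ' : LTL A} {i : ℕ} :
    HoldsAt u (release ψ ψ') i ↔
      HoldsAt u ψ' i ∧ (HoldsAt u ψ i ∨ HoldsAt u (release ψ ψ') (i + 1)) := by
  simp only [HoldsAt]
  constructor
  · refine fun h => ⟨(h i le_rfl).resolve_right fun ⟨k, hk, hk', _⟩ => by omega, ?_⟩
    by_cases h₀ : HoldsAt u ψ i
    · exact Or.inl h₀
    · refine Or.inr fun j hj => (h j (by omega)).imp_right ?_
      rintro ⟨k, hk, hkj, h₁⟩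
      rcases hk.eq_or_lt with rfl | hk
      · exact absurd h₁ h₀
      · exact ⟨k, hk, hkj, h₁⟩
  · rintro ⟨h, h'⟩ j hj
    rcases hj.eq_or_lt with rfl | hj
    · exact Or.inl h
    · rcases h' with h' | h'
      · exact Or.inr ⟨i, le_rfl, hj, h'⟩
      · exact (h' j hj).imp_right fun ⟨k, hk, hk'⟩ => ⟨k, by omega, hk'⟩

/-- The transition conditions are the expansion laws, unfolded down to literals and `○`; thus truth
is a consistent labelling. -/
theorem sat_trans_iff_holdsAt {u : ℕ → A} {i : ℕ} (ψ : LTL A) (h : ψ ∈ φ.subformulas) :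
    (trans ψ h).Sat (u i) {q : φ.Sub | HoldsAt u q.1 (i + 1)} ↔ HoldsAt u ψ i := by
  induction ψ with
  | letter a | negLetter a => simp [trans, TransCond.Sat, HoldsAt]
  | or ψ₀ ψ₁ h₀ h₁ | and ψ₀ ψ₁ h₀ h₁ => simp only [trans, TransCond.Sat, HoldsAt, h₀, h₁]
  | next ψ₀ _ => rfl
  | eventually ψ₀ h₀ =>
    rw [holdsAt_eventually_iff]; simp only [trans, TransCond.Sat, h₀]; rfl
  | always ψ₀ h₀ =>
    rw [holdsAt_always_iff]; simp only [trans, TransCond.Sat, h₀]; rfl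
  | untl ψ₀ ψ₁ h₀ h₁ =>
    rw [holdsAt_untl_iff]; simp only [trans, TransCond.Sat, h₀, h₁]; rfl
  | release ψ₀ ψ₁ h₀ h₁ =>
    rw [holdsAt_release_iff]; simp only [trans, TransCond.Sat, h₀, h₁]; rfl

/-! ### Acceptance by the alternating automaton -/

/-- The run graph of all true vertices; a disjunction is left to its right-hand side only if its
left-hand side is false. -/
def canonicalVerts (φ : LTL A) (R : Set φ.Sub) (u : ℕ → A) :
    AltAutomaton.Vertex A φ.Sub → Prop
  | (i, .inl q) => HoldsAt u q.1 i
  | (i, .inr τ) => (∃ q, τ.Subcond ((φ.toAlt R).δ q)) ∧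
      τ.Sat (u i) {q | HoldsAt u q.1 (i + 1)}

/-- The successor relation of the canonical run graph. -/
def canonicalSucc (φ : LTL A) (R : Set φ.Sub) (u : ℕ → A) :
    AltAutomaton.Vertex A φ.Sub → AltAutomaton.Vertex A φ.Sub → Prop
  | (i, .inl q), y => y = (i, .inr ((φ.toAlt R).δ q))
  | (_, .inr (.letters _)), _ => False
  | (i, .inr (.next q)), y => y = (i + 1, .inl q)
  | (i, .inr (.or τ₀ τ₁)), y =>
      (τ₀.Sat (u i) {q | HoldsAt u q.1 (i + 1)} ∧ y = (i, .inr τ₀)) ∨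
      (¬ τ₀.Sat (u i) {q | HoldsAt u q.1 (i + 1)} ∧ y = (i, .inr τ₁))
  | (i, .inr (.and τ₀ τ₁)), y => y = (i, .inr τ₀) ∨ y = (i, .inr τ₁)

theorem canonicalVerts_of_succ {R : Set φ.Sub} {u : ℕ → A} {x y : AltAutomaton.Vertex A φ.Sub}
    (hx : canonicalVerts φ R u x) (h : canonicalSucc φ R u x y) : canonicalVerts φ R u y := by
  obtain ⟨i, q | τ⟩ := x
  · simp only [canonicalSucc] at h
    subst h
    exact ⟨⟨q, TransCond.Subcond.refl _⟩, (sat_trans_iff_holdsAt _ _).2 hx⟩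
  · obtain ⟨⟨q, hq⟩, hx⟩ := hx
    cases τ with
    | letters B => exact h.elim
    | next q' =>
      simp only [canonicalSucc] at h
      subst h
      exact hx
    | or τ₀ τ₁ =>
      simp only [canonicalSucc] at h
      rcases h with ⟨h, rfl⟩ | ⟨h, rfl⟩
      · exact ⟨⟨q, .trans (by simp [TransCond.Subcond, TransCond.Subcond.refl]) hq⟩, h⟩
      · exact ⟨⟨q, .trans (by simp [TransCond.Subcond, TransCond.Subcond.refl]) hq⟩,
          hx.resolve_left h⟩
    | and τ₀ τ₁ =>
      simp only [canonicalSucc] at h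
      rcases h with rfl | rfl
      · exact ⟨⟨q, .trans (by simp [TransCond.Subcond, TransCond.Subcond.refl]) hq⟩, hx.1⟩
      · exact ⟨⟨q, .trans (by simp [TransCond.Subcond, TransCond.Subcond.refl]) hq⟩, hx.2⟩

/-- The run graph of all true vertices. -/
def canonicalRunGraph (φ : LTL A) (R : Set φ.Sub) (u : ℕ → A) : (φ.toAlt R).RunGraph u where
  verts := {x | canonicalVerts φ R u x}
  edge x y := canonicalVerts φ R u x ∧ canonicalSucc φ R u x y
  edge_mem _ _ h := ⟨h.1, canonicalVerts_of_succ h.1 h.2⟩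
  cond_mem _ _ h := h.1
  edge_state _ _ h _ := and_iff_right h
  edge_next _ _ h _ := and_iff_right h
  edge_or i τ₀ τ₁ h := by
    refine ⟨fun y hy => hy.2.imp And.right And.right, ?_⟩
    by_cases h₀ : τ₀.Sat (u i) {q | HoldsAt u q.1 (i + 1)}
    · exact ⟨_, h, Or.inl ⟨h₀, rfl⟩⟩
    · exact ⟨_, h, Or.inr ⟨h₀, rfl⟩⟩
  edge_and _ _ _ h _ := and_iff_right h
  edge_letters _ _ _ _ h := h.2
  letters_mem _ _ h := h.2

/-- Only states of formulas shorter than `m` occur at or after the vertex. -/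
def LengthLT (m : ℕ) : AltAutomaton.Vertex A φ.Sub → Prop
  | (_, .inl q) => q.1.length < m
  | (_, .inr τ) => ∀ q, (TransCond.next q).Subcond τ → q.1.length < m

/-- Once a path has descended to formulas shorter than `m`, it never returns to one of length `m`.
-/
theorem LengthLT.succ {R : Set φ.Sub} {u : ℕ → A} {m : ℕ} {x y : AltAutomaton.Vertex A φ.Sub}
    (hx : LengthLT m x) (h : canonicalSucc φ R u x y) : LengthLT m y := by
  obtain ⟨i, q | τ⟩ := x
  · simp only [canonicalSucc] at h
    subst h
    exact fun q' hq' => (length_le_of_next_subcond_trans hq').trans_lt hx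
  · cases τ with
    | letters B => exact h.elim
    | next q' =>
      simp only [canonicalSucc] at h
      subst h
      exact hx q' rfl
    | or τ₀ τ₁ =>
      simp only [canonicalSucc] at h
      rcases h with ⟨-, rfl⟩ | ⟨-, rfl⟩
      · exact fun q hq => hx q (Or.inr (Or.inl hq))
      · exact fun q hq => hx q (Or.inr (Or.inr hq))
    | and τ₀ τ₁ =>
      simp only [canonicalSucc] at h
      rcases h with rfl | rfl
      · exact fun q hq => hx q (Or.inr (Or.inl hq))
      · exact fun q hq => hx q (Or.inr (Or.inr hq))

theorem lengthLT_trans {m i : ℕ} {ψ : LTL A} (h : ψ ∈ φ.subformulas) (hm : ψ.length < m) :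
    LengthLT m (i, .inr (trans ψ h)) :=
  fun _ hq => (length_le_of_next_subcond_trans hq).trans_lt hm

theorem isFinal_canonicalRunGraph {R : Set φ.Sub} (hR : φ.IsRecurringSet R) (u : ℕ → A) :
    (canonicalRunGraph φ R u).IsFinal := by
  intro p hp q hq
  by_contra hqR
  have hqR' : q ∉ R := hqR
  -- As `q` recurs, the path cannot descend below its length. After a visit to `q` it can thus only
  -- follow the self-loop of `q`.
  have hnot (k : ℕ) : ¬ LengthLT q.1.length (p k) := by
    intro hk
    have hle (l : ℕ) : LengthLT q.1.length (p (k + l)) := by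
      induction l with
      | zero => exact hk
      | succ l ih => exact ih.succ (hp (k + l)).2
    obtain ⟨l, hl, i, hi⟩ := frequently_atTop.1 hq k
    have := hle (l - k)
    rw [Nat.add_sub_cancel' hl, hi] at this
    exact lt_irrefl _ this
  obtain ⟨k, i, hk⟩ := hq.exists
  have hv := (hp k).1
  rw [hk] at hv
  have hnext {k i : ℕ} (hk : p k = (i, .inl q)) : p (k + 1) = (i, .inr (trans q.1 q.2)) := by
    have := (hp k).2
    rw [hk] at this
    exact this
  obtain ⟨ψ, hψ⟩ := q
  cases ψ with
  | letter a | negLetter a =>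
    have := (hp (k + 1)).2
    rw [hnext hk] at this
    exact this
  | or ψ₀ ψ₁ | and ψ₀ ψ₁ =>
    refine hnot (k + 1) ?_
    rw [hnext hk]
    rintro q (hq | hq | hq)
    · cases hq
    all_goals
      refine (length_le_of_next_subcond_trans hq).trans_lt ?_
      simp only [length]; omega
  | next ψ₀ =>
    refine hnot (k + 1) ?_
    rw [hnext hk]
    intro q hq
    simp only [trans, TransCond.Subcond, TransCond.next.injEq] at hq
    simp [hq, length]
  | always ψ₀ => exact hqR' ((hR _).2.2.1 _ rfl)
  | release ψ₀ ψ₁ => exact hqR' ((hR _).2.2.2 _ _ rfl)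
  | eventually ψ₀ =>
    -- The left disjunct is shorter, so the path takes the right one, which happens only where `ψ₀`
    -- fails. A round has three edges: state, disjunction, `○`, next state.
    have hstep {k i : ℕ} (hk : p k = (i, .inl ⟨eventually ψ₀, hψ⟩)) :
        ¬ HoldsAt u ψ₀ i ∧ p (k + 3) = (i + 1, .inl ⟨eventually ψ₀, hψ⟩) := by
      have h1 := (hp (k + 1)).2
      rw [hnext hk] at h1
      rcases h1 with ⟨-, h1⟩ | ⟨h0, h1⟩
      · refine (hnot (k + 2) ?_).elim
        rw [h1]
        exact lengthLT_trans _ (by simp only [length]; omega)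
      · have h2 := (hp (k + 2)).2
        rw [h1] at h2
        exact ⟨fun h => h0 ((sat_trans_iff_holdsAt _ _).2 h), h2⟩
    have hall (l : ℕ) : p (k + 3 * l) = (i + l, .inl ⟨eventually ψ₀, hψ⟩) := by
      induction l with
      | zero => exact hk
      | succ l ih => exact (hstep ih).2
    obtain ⟨j, hj, h⟩ := hv
    obtain ⟨l, rfl⟩ := Nat.exists_eq_add_of_le hj
    exact (hstep (hall l)).1 h
  | untl ψ₀ ψ₁ =>
    -- The conjunction adds a fourth edge to the round.
    have hstep {k i : ℕ} (hk : p k = (i, .inl ⟨untl ψ₀ ψ₁, hψ⟩)) :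
        ¬ HoldsAt u ψ₁ i ∧ p (k + 4) = (i + 1, .inl ⟨untl ψ₀ ψ₁, hψ⟩) := by
      have h1 := (hp (k + 1)).2
      rw [hnext hk] at h1
      rcases h1 with ⟨-, h1⟩ | ⟨h0, h1⟩
      · refine (hnot (k + 2) ?_).elim
        rw [h1]
        exact lengthLT_trans _ (by simp only [length]; omega)
      · refine ⟨fun h => h0 ((sat_trans_iff_holdsAt _ _).2 h), ?_⟩
        have h2 := (hp (k + 2)).2
        rw [h1] at h2
        rcases h2 with h2 | h2
        · refine (hnot (k + 3) ?_).elim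
          rw [h2]
          exact lengthLT_trans _ (by simp only [length]; omega)
        · have h3 := (hp (k + 3)).2
          rw [h2] at h3
          exact h3
    have hall (l : ℕ) : p (k + 4 * l) = (i + l, .inl ⟨untl ψ₀ ψ₁, hψ⟩) := by
      induction l with
      | zero => exact hk
      | succ l ih => exact (hstep ih).2
    obtain ⟨j, hj, h, -⟩ := hv
    obtain ⟨l, rfl⟩ := Nat.exists_eq_add_of_le hj
    exact (hstep (hall l)).1 h

end LTL

/-! ### Paths in arbitrary run graphs -/

namespace AltAutomaton.RunGraph

variable {A : Type u} {Q : Type v} {𝒜 : AltAutomaton A Q} {u : ℕ → A} (G : 𝒜.RunGraph u)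

theorem delta_mem {i : ℕ} {q : Q} (h : (i, .inl q) ∈ G.verts) : (i, .inr (𝒜.δ q)) ∈ G.verts :=
  (G.edge_mem _ _ ((G.edge_state i q h _).2 rfl)).2

theorem next_mem {i : ℕ} {q : Q} (h : (i, .inr (.next q)) ∈ G.verts) :
    (i + 1, .inl q) ∈ G.verts :=
  (G.edge_mem _ _ ((G.edge_next i q h _).2 rfl)).2

theorem or_mem {i : ℕ} {τ₀ τ₁ : TransCond A Q} (h : (i, .inr (.or τ₀ τ₁)) ∈ G.verts) :
    (i, .inr τ₀) ∈ G.verts ∨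
      ((i, .inr τ₁) ∈ G.verts ∧ G.edge (i, .inr (.or τ₀ τ₁)) (i, .inr τ₁)) := by
  obtain ⟨hor, y, hy⟩ := G.edge_or i τ₀ τ₁ h
  rcases hor y hy with rfl | rfl
  · exact Or.inl (G.edge_mem _ _ hy).2
  · exact Or.inr ⟨(G.edge_mem _ _ hy).2, hy⟩

theorem and_mem {i : ℕ} {τ₀ τ₁ : TransCond A Q} (h : (i, .inr (.and τ₀ τ₁)) ∈ G.verts) :
    (i, .inr τ₀) ∈ G.verts ∧ (i, .inr τ₁) ∈ G.verts :=
  ⟨(G.edge_mem _ _ ((G.edge_and i τ₀ τ₁ h _).2 (Or.inl rfl))).2,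
    (G.edge_mem _ _ ((G.edge_and i τ₀ τ₁ h _).2 (Or.inr rfl))).2⟩

/-- A final run graph has no infinite path that passes periodically through a non-recurring
state. -/
theorem IsFinal.mem_recurring {G : 𝒜.RunGraph u} (hG : G.IsFinal) {q : Q} {m i : ℕ}
    (f : ℕ → ℕ → Vertex A Q) (h0 : ∀ j, f j 0 = (i + j, .inl q))
    (hf : ∀ j, ∀ s < m, G.edge (f j s) (f j (s + 1)))
    (hl : ∀ j, G.edge (f j m) (f (j + 1) 0)) : q ∈ 𝒜.recurring := by
  -- The rounds `f j`, of `m + 1` vertices each, are concatenated by division with remainder; a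
  -- round starts with `q` at every multiple of `m + 1`.
  refine hG (fun k => f (k / (m + 1)) (k % (m + 1))) (fun k => ?_) q
    (frequently_atTop.2 fun k => ⟨(m + 1) * k, Nat.le_mul_of_pos_left _ (by omega), i + k, ?_⟩)
  · have hlt : k % (m + 1) < m + 1 := Nat.mod_lt _ (by omega)
    by_cases hk : k % (m + 1) = m
    · have h1 : (k + 1) / (m + 1) = k / (m + 1) + 1 := by
        rw [Nat.succ_div_of_dvd]
        exact Nat.dvd_of_mod_eq_zero (by rw [Nat.add_mod]; simp [hk])
      have h2 : (k + 1) % (m + 1) = 0 := by rw [Nat.add_mod]; simp [hk]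
      simp only [h1, h2, hk]
      exact hl _
    · have h2 : (k + 1) % (m + 1) = k % (m + 1) + 1 := by
        rw [Nat.add_mod, Nat.mod_eq_of_lt (a := k % (m + 1) + 1 % (m + 1))]
        · rw [Nat.mod_eq_of_lt (a := 1)]; omega
        · rw [Nat.mod_eq_of_lt (a := 1)] <;> omega
      have h1 : (k + 1) / (m + 1) = k / (m + 1) := by
        rw [Nat.succ_div_of_not_dvd]
        intro hd
        rw [Nat.mod_eq_zero_of_dvd hd] at h2
        omega
      simp only [h1, h2]
      exact hf _ _ (by omega)
  · simp only [Nat.mul_div_cancel_left k (Nat.succ_pos m), Nat.mul_mod_right, h0]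

end AltAutomaton.RunGraph

/-! ### Soundness of acceptance by the alternating automaton -/

namespace LTL

variable {A : Type u} {φ : LTL A}

/-- The induction runs over condition vertices, not state vertices, because `δ` inlines the
conditions of the operands: their states need not occur in the graph. -/
theorem holdsAt_of_mem_verts {R : Set φ.Sub} (hR : φ.IsRecurringSet R) {u : ℕ → A}
    {G : (φ.toAlt R).RunGraph u} (hG : G.IsFinal) (ψ : LTL A) (hψ : ψ ∈ φ.subformulas) (i : ℕ)
    (h : (i, .inr (trans ψ hψ)) ∈ G.verts) : HoldsAt u ψ i := by
  induction ψ generalizing i with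
  | letter a | negLetter a => exact G.letters_mem i _ h
  | or ψ₀ ψ₁ h₀ h₁ =>
    exact (G.or_mem h).imp (h₀ _ _) fun h => h₁ _ _ h.1
  | and ψ₀ ψ₁ h₀ h₁ => exact (G.and_mem h).imp (h₀ _ _) (h₁ _ _)
  | next ψ₀ h₀ => exact h₀ _ _ (G.delta_mem (G.next_mem h))
  | always ψ₀ h₀ =>
    have hall (l : ℕ) : (i + l, .inr (trans (always ψ₀) hψ)) ∈ G.verts := by
      induction l with
      | zero => exact h
      | succ l ih => exact G.delta_mem (G.next_mem (G.and_mem ih).2)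
    intro j hj
    obtain ⟨l, rfl⟩ := Nat.exists_eq_add_of_le hj
    exact h₀ _ _ (G.and_mem (hall l)).1
  | release ψ₀ ψ₁ h₀ h₁ =>
    -- If the formula fails, `ψ₀` can never release, so the graph stays in the loop and verifies
    -- `ψ₁` at every position, which makes the formula true.
    by_contra hn
    have hstep {j : ℕ} (h : (j, .inr (trans (release ψ₀ ψ₁) hψ)) ∈ G.verts)
        (hn : ¬ HoldsAt u (release ψ₀ ψ₁) j) :
        HoldsAt u ψ₁ j ∧ (j + 1, .inr (trans (release ψ₀ ψ₁) hψ)) ∈ G.verts ∧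
          ¬ HoldsAt u (release ψ₀ ψ₁) (j + 1) := by
      have h1 := h₁ _ _ (G.and_mem h).1
      rw [holdsAt_release_iff] at hn
      refine ⟨h1, ?_, fun h' => hn ⟨h1, Or.inr h'⟩⟩
      rcases G.or_mem (G.and_mem h).2 with h' | h'
      · exact absurd ⟨h1, Or.inl (h₀ _ _ h')⟩ hn
      · exact G.delta_mem (G.next_mem h'.1)
    have hall (l : ℕ) : (i + l, .inr (trans (release ψ₀ ψ₁) hψ)) ∈ G.verts ∧
          ¬ HoldsAt u (release ψ₀ ψ₁) (i + l) := by
      induction l with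
      | zero => exact ⟨h, hn⟩
      | succ l ih => exact (hstep ih.1 ih.2).2
    refine hn fun j hj => Or.inl ?_
    obtain ⟨l, rfl⟩ := Nat.exists_eq_add_of_le hj
    exact (hstep (hall l).1 (hall l).2).1
  | eventually ψ₀ h₀ =>
    by_contra hn
    have hstep {j : ℕ} (h : (j, .inr (trans (eventually ψ₀) hψ)) ∈ G.verts)
        (hn : ¬ HoldsAt u (eventually ψ₀) j) :
        G.edge (j, .inr (trans (eventually ψ₀) hψ)) (j, .inr (.next ⟨eventually ψ₀, hψ⟩)) ∧
        (j, .inr (.next ⟨eventually ψ₀, hψ⟩)) ∈ G.verts ∧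
          ¬ HoldsAt u (eventually ψ₀) (j + 1) := by
      rw [holdsAt_eventually_iff] at hn
      rcases G.or_mem h with h' | h'
      · exact absurd (Or.inl (h₀ _ _ h')) hn
      · exact ⟨h'.2, h'.1, fun h => hn (Or.inr h)⟩
    have hall (l : ℕ) : (i + l, .inr (trans (eventually ψ₀) hψ)) ∈ G.verts ∧
          ¬ HoldsAt u (eventually ψ₀) (i + l) := by
      induction l with
      | zero => exact ⟨h, hn⟩
      | succ l ih =>
        have := hstep ih.1 ih.2
        exact ⟨G.delta_mem (G.next_mem this.2.1), this.2.2⟩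
    -- The periodic path starts at `i + 1`: at position `i` only the condition is known to be a
    -- vertex, the state itself being reached through `○`.
    refine (hR ⟨eventually ψ₀, hψ⟩).1 _ rfl (hG.mem_recurring (m := 2) (i := i + 1) (fun j s =>
      match s with
      | 0 => (i + 1 + j, .inl ⟨eventually ψ₀, hψ⟩)
      | 1 => (i + 1 + j, .inr (trans (eventually ψ₀) hψ))
      | _ => (i + 1 + j, .inr (.next ⟨eventually ψ₀, hψ⟩))) (fun j => rfl) ?_ ?_)
    all_goals intro j
    all_goals
      have e : i + 1 + j = i + (j + 1) := by ring
      have h1 := hall j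
      have h2 := hall (j + 1)
      rw [← e] at h2
      have h3 := hstep h1.1 h1.2
      have h4 := hstep h2.1 h2.2
    · intro s hs
      interval_cases s
      · refine (G.edge_state _ _ ?_ _).2 rfl
        have := G.next_mem h3.2.1
        rwa [show i + j + 1 = i + 1 + j by ring] at this
      · exact h4.1
    · exact (G.edge_next _ _ h4.2.1 _).2 rfl
  | untl ψ₀ ψ₁ h₀ h₁ =>
    by_contra hn
    have hstep {j : ℕ} (h : (j, .inr (trans (untl ψ₀ ψ₁) hψ)) ∈ G.verts)
        (hn : ¬ HoldsAt u (untl ψ₀ ψ₁) j) :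
        G.edge (j, .inr (trans (untl ψ₀ ψ₁) hψ))
          (j, .inr (.and (trans ψ₀ (sub_untl hψ).1) (.next ⟨untl ψ₀ ψ₁, hψ⟩))) ∧
        G.edge (j, .inr (.and (trans ψ₀ (sub_untl hψ).1) (.next ⟨untl ψ₀ ψ₁, hψ⟩)))
          (j, .inr (.next ⟨untl ψ₀ ψ₁, hψ⟩)) ∧
        (j, .inr (.next ⟨untl ψ₀ ψ₁, hψ⟩)) ∈ G.verts ∧
          ¬ HoldsAt u (untl ψ₀ ψ₁) (j + 1) := by
      rw [holdsAt_untl_iff] at hn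
      rcases G.or_mem h with h' | h'
      · exact absurd (Or.inl (h₁ _ _ h')) hn
      · have ha := G.and_mem h'.1
        exact ⟨h'.2, (G.edge_and _ _ _ h'.1 _).2 (Or.inr rfl), ha.2,
          fun h => hn (Or.inr ⟨h₀ _ _ ha.1, h⟩)⟩
    have hall (l : ℕ) : (i + l, .inr (trans (untl ψ₀ ψ₁) hψ)) ∈ G.verts ∧
          ¬ HoldsAt u (untl ψ₀ ψ₁) (i + l) := by
      induction l with
      | zero => exact ⟨h, hn⟩
      | succ l ih =>
        have := hstep ih.1 ih.2
        exact ⟨G.delta_mem (G.next_mem this.2.2.1), this.2.2.2⟩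
    refine (hR ⟨untl ψ₀ ψ₁, hψ⟩).2.1 _ _ rfl (hG.mem_recurring (m := 3) (i := i + 1) (fun j s =>
      match s with
      | 0 => (i + 1 + j, .inl ⟨untl ψ₀ ψ₁, hψ⟩)
      | 1 => (i + 1 + j, .inr (trans (untl ψ₀ ψ₁) hψ))
      | 2 => (i + 1 + j, .inr (.and (trans ψ₀ (sub_untl hψ).1) (.next ⟨untl ψ₀ ψ₁, hψ⟩)))
      | _ => (i + 1 + j, .inr (.next ⟨untl ψ₀ ψ₁, hψ⟩))) (fun j => rfl) ?_ ?_)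
    all_goals intro j
    all_goals
      have e : i + 1 + j = i + (j + 1) := by ring
      have h1 := hall j
      have h2 := hall (j + 1)
      rw [← e] at h2
      have h3 := hstep h1.1 h1.2
      have h4 := hstep h2.1 h2.2
    · intro s hs
      interval_cases s
      · refine (G.edge_state _ _ ?_ _).2 rfl
        have := G.next_mem h3.2.2.1
        rwa [show i + j + 1 = i + 1 + j by ring] at this
      · exact h4.1
      · exact h4.2.1
    · exact (G.edge_next _ _ h4.2.2.1 _).2 rfl

theorem acceptsFrom_toAlt_iff {R : Set φ.Sub} (hR : φ.IsRecurringSet R) (u : ℕ → A) (i : ℕ)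
    (q : φ.Sub) : (φ.toAlt R).AcceptsFrom u i q ↔ HoldsAt u q.1 i :=
  ⟨fun ⟨G, hG, h⟩ => holdsAt_of_mem_verts hR hG q.1 q.2 i (G.delta_mem h),
    fun h => ⟨canonicalRunGraph φ R u, isFinal_canonicalRunGraph hR u, h⟩⟩

/-! ### The backward automaton -/

/-- The obligation of a temporal formula is not pending in the set `S` of true formulas. -/
def Fair (S : Set φ.Sub) : (ψ : LTL A) → ψ ∈ φ.subformulas → Prop
  | eventually ψ, h => ⟨eventually ψ, h⟩ ∈ S → ⟨ψ, sub_eventually h⟩ ∈ S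
  | always ψ, h => ⟨ψ, sub_always h⟩ ∈ S → ⟨always ψ, h⟩ ∈ S
  | untl ψ ψ', h => ⟨untl ψ ψ', h⟩ ∈ S → ⟨ψ', (sub_untl h).2⟩ ∈ S
  | release ψ ψ', h => ⟨ψ', (sub_release h).2⟩ ∈ S → ⟨release ψ ψ', h⟩ ∈ S
  | letter _, _ | negLetter _, _ | or _ _, _ | and _ _, _ | next _, _ => True

/-- For a temporal formula the operands have values in `{0, ⊤}` and the self-loop has a value in
`{1, ⊤}`. A result `1` means that the formula's label is decided by the self-loop alone: for `F` and
`U` it is true without the goal holding now, for `G` and `R` it is false although `ψ` resp. `ψ'`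
holds now. `Fair` excludes just this. -/
theorem rawVal_eq_top_or_zero_iff {R : Set φ.Sub} (hR : φ.IsRecurringSet R) (a : A)
    (w : (φ.toAlt R).toBackward.State) (q : φ.Sub) :
    ((φ.toAlt R).rawVal a w.1 q = ⊤ ∨ (φ.toAlt R).rawVal a w.1 q = 0) ↔
      Fair ((φ.toAlt R).output ((φ.toAlt R).toBackward.step a w)) q.1 q.2 := by
  have hA := isVeryWeak_toAlt (φ := φ) R
  have hout (q : φ.Sub) : q ∈ (φ.toAlt R).output ((φ.toAlt R).toBackward.step a w) ↔
      (trans q.1 q.2).Sat a ((φ.toAlt R).acceptedStates w.1) :=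
    AltAutomaton.mem_acceptedStates_liftVal hA.isWeak
  have hw := hA.eq_top_or_one w.2 q
  have hself (q : φ.Sub) : (φ.toAlt R).SameSCC q q := ⟨.refl, .refl⟩
  obtain ⟨ψ, hψ⟩ := q
  have hqR := hR ⟨ψ, hψ⟩
  cases ψ with
  | letter a | negLetter a =>
    exact iff_of_true (AltAutomaton.rawVal_eq_top_or_zero hA nofun) trivial
  | or ψ₀ ψ₁ | and ψ₀ ψ₁ =>
    refine iff_of_true (AltAutomaton.rawVal_eq_top_or_zero hA ?_) trivial
    rintro (hq | hq | hq)
    · cases hq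
    all_goals
      have := length_le_of_next_subcond_trans hq
      simp only [length] at this; omega
  | next ψ₀ =>
    refine iff_of_true (AltAutomaton.rawVal_eq_top_or_zero hA fun hq => ?_) trivial
    -- A self-loop would identify `ψ₀` with `next ψ₀`; comparing lengths refutes this.
    have h := congrArg (fun τ : TransCond A φ.Sub => match τ with
      | .next q => q.1.length
      | _ => 0) hq
    simp [length] at h
  | eventually ψ₀ =>
    have hq : (⟨eventually ψ₀, hψ⟩ : φ.Sub) ∉ (φ.toAlt R).recurring := hqR.1 _ rfl
    have h0 := AltAutomaton.evalN_eq_top_or_zero (a := a) (w := w.1) hA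
      (not_next_subcond_trans (q := ⟨eventually ψ₀, hψ⟩) (h := sub_eventually hψ)
        (by simp only [length]; omega))
    -- The condition of `ψ₀` is evaluated at the state of the `F` formula, so it does not matter on
    -- which side the state of `ψ₀` was put.
    have hs := AltAutomaton.evalN_ne_top_iff (a := a) (w := w.1) hA.isWeak hq
      (trans ψ₀ (sub_eventually hψ))
    have hs' := AltAutomaton.evalN_ne_top_iff (a := a) (w := w.1) hA.isWeak hq
      (trans _ hψ)
    simp only [Fair, hout]
    rw [AltAutomaton.rawVal, if_neg hq, ← hs, ← hs']
    simp only [toAlt, trans, AltAutomaton.evalN] at *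
    rw [if_pos (hself _)]
    rcases h0 with h | h <;> rcases hw with h' | h' <;> simp [h, h']
  | always ψ₀ =>
    have hq : (⟨always ψ₀, hψ⟩ : φ.Sub) ∈ (φ.toAlt R).recurring := hqR.2.2.1 _ rfl
    have h0 := AltAutomaton.evalR_eq_top_or_zero (a := a) (w := w.1) hA
      (not_next_subcond_trans (q := ⟨always ψ₀, hψ⟩) (h := sub_always hψ)
        (by simp only [length]; omega))
    have hs := AltAutomaton.evalR_eq_top_iff (a := a) (w := w.1) hA.isWeak hq
      (trans ψ₀ (sub_always hψ))
    have hs' := AltAutomaton.evalR_eq_top_iff (a := a) (w := w.1) hA.isWeak hq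
      (trans _ hψ)
    simp only [Fair, hout]
    rw [AltAutomaton.rawVal, if_pos hq, ← hs, ← hs']
    simp only [toAlt, trans, AltAutomaton.evalR] at *
    rw [if_pos (hself _)]
    rcases h0 with h | h <;> rcases hw with h' | h' <;> simp [h, h']
  | untl ψ₀ ψ₁ =>
    have hq : (⟨untl ψ₀ ψ₁, hψ⟩ : φ.Sub) ∉ (φ.toAlt R).recurring := hqR.2.1 _ _ rfl
    have h0 := AltAutomaton.evalN_eq_top_or_zero (a := a) (w := w.1) hA
      (not_next_subcond_trans (q := ⟨untl ψ₀ ψ₁, hψ⟩) (h := (sub_untl hψ).1)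
        (by simp only [length]; omega))
    have h1 := AltAutomaton.evalN_eq_top_or_zero (a := a) (w := w.1) hA
      (not_next_subcond_trans (q := ⟨untl ψ₀ ψ₁, hψ⟩) (h := (sub_untl hψ).2)
        (by simp only [length]; omega))
    have hs := AltAutomaton.evalN_ne_top_iff (a := a) (w := w.1) hA.isWeak hq
      (trans ψ₁ (sub_untl hψ).2)
    have hs' := AltAutomaton.evalN_ne_top_iff (a := a) (w := w.1) hA.isWeak hq
      (trans _ hψ)
    simp only [Fair, hout]
    rw [AltAutomaton.rawVal, if_neg hq, ← hs, ← hs']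
    simp only [toAlt, trans, AltAutomaton.evalN] at *
    rw [if_pos (hself _)]
    rcases h0 with h | h <;> rcases h1 with h'' | h'' <;> rcases hw with h' | h' <;>
      simp [h, h', h'']
  | release ψ₀ ψ₁ =>
    have hq : (⟨release ψ₀ ψ₁, hψ⟩ : φ.Sub) ∈ (φ.toAlt R).recurring := hqR.2.2.2 _ _ rfl
    have h0 := AltAutomaton.evalR_eq_top_or_zero (a := a) (w := w.1) hA
      (not_next_subcond_trans (q := ⟨release ψ₀ ψ₁, hψ⟩) (h := (sub_release hψ).1)
        (by simp only [length]; omega))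
    have h1 := AltAutomaton.evalR_eq_top_or_zero (a := a) (w := w.1) hA
      (not_next_subcond_trans (q := ⟨release ψ₀ ψ₁, hψ⟩) (h := (sub_release hψ).2)
        (by simp only [length]; omega))
    have hs := AltAutomaton.evalR_eq_top_iff (a := a) (w := w.1) hA.isWeak hq
      (trans ψ₁ (sub_release hψ).2)
    have hs' := AltAutomaton.evalR_eq_top_iff (a := a) (w := w.1) hA.isWeak hq
      (trans _ hψ)
    simp only [Fair, hout]
    rw [AltAutomaton.rawVal, if_pos hq, ← hs, ← hs']
    simp only [toAlt, trans, AltAutomaton.evalR] at *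
    rw [if_pos (hself _)]
    rcases h0 with h | h <;> rcases h1 with h'' | h'' <;> rcases hw with h' | h' <;>
      simp [h, h', h'']

/-- The right-hand side sees `w` only through the state before the letter, which makes the
acceptance condition state-based. -/
theorem mem_buchi_iff_fair {R : Set φ.Sub} (hR : φ.IsRecurringSet R)
    {j : (φ.toAlt R).toBackward.Index} {q : φ.Sub} (hq : q ∈ j.1.1) (a : A)
    (w : (φ.toAlt R).toBackward.State) :
    ((φ.toAlt R).toBackward.step a w, a, w) ∈ (φ.toAlt R).toBackward.buchi j ↔
      Fair ((φ.toAlt R).output ((φ.toAlt R).toBackward.step a w)) q.1 q.2 := by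
  rw [(isVeryWeak_toAlt R).mem_buchi_iff hq, rawVal_eq_top_or_zero_iff hR]

theorem isStateBased_toBackward {R : Set φ.Sub} (hR : φ.IsRecurringSet R) :
    (φ.toAlt R).toBackward.IsStateBased := by
  refine ⟨fun j => {v | ∀ q ∈ j.1.1, Fair ((φ.toAlt R).output v) q.1 q.2}, fun j a w => ?_⟩
  refine ⟨fun h q hq => (mem_buchi_iff_fair hR hq a w).1 h, fun h => ?_⟩
  obtain ⟨q, hq⟩ : ∃ q, q ∈ j.1.1 := Finset.card_pos.1 (Fin.pos j.2)
  exact (mem_buchi_iff_fair hR hq a w).2 (h q hq)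

/-- A consistent labelling of the positions of a word with sets of subformulas in which
obligations are fulfilled infinitely often is the labelling with the true subformulas. -/
theorem mem_iff_holdsAt_of_frequently_fair {u : ℕ → A} {O : ℕ → Set φ.Sub}
    (hO : ∀ i (q : φ.Sub), q ∈ O i ↔ (trans q.1 q.2).Sat (u i) (O (i + 1)))
    (hfair : ∀ q : φ.Sub, ∃ᶠ i in atTop, Fair (O i) q.1 q.2)
    (ψ : LTL A) (hψ : ψ ∈ φ.subformulas) (i : ℕ) :
    (⟨ψ, hψ⟩ : φ.Sub) ∈ O i ↔ HoldsAt u ψ i := by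
  have hO' (i : ℕ) (ψ : LTL A) (hψ : ψ ∈ φ.subformulas) :
      (trans ψ hψ).Sat (u i) (O (i + 1)) ↔ (⟨ψ, hψ⟩ : φ.Sub) ∈ O i := (hO i ⟨ψ, hψ⟩).symm
  have hf := frequently_atTop.1 (hfair ⟨ψ, hψ⟩)
  induction ψ generalizing i with
  | letter a | negLetter a => rw [hO]; simp [trans, TransCond.Sat, HoldsAt]
  | or ψ₀ ψ₁ h₀ h₁ | and ψ₀ ψ₁ h₀ h₁ =>
    rw [hO]
    simp only [trans, TransCond.Sat, HoldsAt, hO', h₀ _ _ (frequently_atTop.1 (hfair ⟨ψ₀, _⟩)),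
      h₁ _ _ (frequently_atTop.1 (hfair ⟨ψ₁, _⟩))]
  | next ψ₀ h₀ =>
    rw [hO]
    exact h₀ _ _ (frequently_atTop.1 (hfair ⟨ψ₀, sub_next hψ⟩))
  | eventually ψ₀ h₀ =>
    replace h₀ (i : ℕ) := h₀ (sub_eventually hψ) i
      (frequently_atTop.1 (hfair ⟨ψ₀, sub_eventually hψ⟩))
    have hstep (i : ℕ) : (⟨eventually ψ₀, hψ⟩ : φ.Sub) ∈ O i ↔
        HoldsAt u ψ₀ i ∨ (⟨eventually ψ₀, hψ⟩ : φ.Sub) ∈ O (i + 1) := by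
      rw [hO]; simp only [trans, TransCond.Sat, hO', h₀]
    simp only [Fair, h₀] at hf
    constructor
    · intro h
      -- Only this direction needs fairness: a label whose goal never holds is passed on forever, up
      -- to a fair position, where the goal must hold.
      by_contra hn
      have hall (l : ℕ) : (⟨eventually ψ₀, hψ⟩ : φ.Sub) ∈ O (i + l) := by
        induction l with
        | zero => exact h
        | succ l ih =>
          exact ((hstep _).1 ih).resolve_left fun h' => hn ⟨_, Nat.le_add_right i l, h'⟩
      obtain ⟨j, hj, h'⟩ := hf i
      obtain ⟨l, rfl⟩ := Nat.exists_eq_add_of_le hj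
      exact hn ⟨_, hj, h' (hall l)⟩
    · rintro ⟨j, hj, h⟩
      -- Consistency alone carries the label back from the witness to `i`.
      refine Nat.decreasingInduction' (fun k _ _ hk => (hstep k).2 (Or.inr hk)) hj
        ((hstep j).2 (Or.inl h))
  | always ψ₀ h₀ =>
    replace h₀ (i : ℕ) := h₀ (sub_always hψ) i
      (frequently_atTop.1 (hfair ⟨ψ₀, sub_always hψ⟩))
    have hstep (i : ℕ) : (⟨always ψ₀, hψ⟩ : φ.Sub) ∈ O i ↔
        HoldsAt u ψ₀ i ∧ (⟨always ψ₀, hψ⟩ : φ.Sub) ∈ O (i + 1) := by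
      rw [hO]; simp only [trans, TransCond.Sat, hO', h₀]
    simp only [Fair, h₀] at hf
    constructor
    · intro h j hj
      have hall (l : ℕ) : (⟨always ψ₀, hψ⟩ : φ.Sub) ∈ O (i + l) := by
        induction l with
        | zero => exact h
        | succ l ih => exact ((hstep _).1 ih).2
      obtain ⟨l, rfl⟩ := Nat.exists_eq_add_of_le hj
      exact ((hstep _).1 (hall l)).1
    · intro h
      -- For `always` and `release` the roles are exchanged: truth implies the label by fairness,
      -- here at `j`, from where the label is carried back to `i`.
      obtain ⟨j, hj, h'⟩ := hf i
      exact Nat.decreasingInduction' (fun k _ hk' hk => (hstep k).2 ⟨h k hk', hk⟩) hj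
        (h' (h j hj))
  | untl ψ₀ ψ₁ h₀ h₁ =>
    replace h₀ (i : ℕ) := h₀ (sub_untl hψ).1 i
      (frequently_atTop.1 (hfair ⟨ψ₀, (sub_untl hψ).1⟩))
    replace h₁ (i : ℕ) := h₁ (sub_untl hψ).2 i
      (frequently_atTop.1 (hfair ⟨ψ₁, (sub_untl hψ).2⟩))
    have hstep (i : ℕ) : (⟨untl ψ₀ ψ₁, hψ⟩ : φ.Sub) ∈ O i ↔
        HoldsAt u ψ₁ i ∨ (HoldsAt u ψ₀ i ∧ (⟨untl ψ₀ ψ₁, hψ⟩ : φ.Sub) ∈ O (i + 1)) := by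
      rw [hO]; simp only [trans, TransCond.Sat, hO', h₀, h₁]
    simp only [Fair, h₁] at hf
    constructor
    · intro h
      by_contra hn
      have hall (l : ℕ) : (⟨untl ψ₀ ψ₁, hψ⟩ : φ.Sub) ∈ O (i + l) ∧
          ¬ HoldsAt u (untl ψ₀ ψ₁) (i + l) := by
        induction l with
        | zero => exact ⟨h, hn⟩
        | succ l ih =>
          have hn' := ih.2
          rw [holdsAt_untl_iff] at hn'
          have h' := ((hstep _).1 ih.1).resolve_left fun h' => hn' (Or.inl h')
          exact ⟨h'.2, fun h'' => hn' (Or.inr ⟨h'.1, h''⟩)⟩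
      obtain ⟨j, hj, h'⟩ := hf i
      obtain ⟨l, rfl⟩ := Nat.exists_eq_add_of_le hj
      exact (hall l).2 (holdsAt_untl_iff.2 (Or.inl (h' (hall l).1)))
    · rintro ⟨j, hj, h, h'⟩
      exact Nat.decreasingInduction' (fun k hk hk' ih => (hstep k).2 (Or.inr ⟨h' k hk' hk, ih⟩)) hj
        ((hstep j).2 (Or.inl h))
  | release ψ₀ ψ₁ h₀ h₁ =>
    replace h₀ (i : ℕ) := h₀ (sub_release hψ).1 i
      (frequently_atTop.1 (hfair ⟨ψ₀, (sub_release hψ).1⟩))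
    replace h₁ (i : ℕ) := h₁ (sub_release hψ).2 i
      (frequently_atTop.1 (hfair ⟨ψ₁, (sub_release hψ).2⟩))
    have hstep (i : ℕ) : (⟨release ψ₀ ψ₁, hψ⟩ : φ.Sub) ∈ O i ↔
        HoldsAt u ψ₁ i ∧ (HoldsAt u ψ₀ i ∨ (⟨release ψ₀ ψ₁, hψ⟩ : φ.Sub) ∈ O (i + 1)) := by
      rw [hO]; simp only [trans, TransCond.Sat, hO', h₀, h₁]
    simp only [Fair, h₁] at hf
    constructor
    · intro h
      by_contra hn
      have hall (l : ℕ) : (⟨release ψ₀ ψ₁, hψ⟩ : φ.Sub) ∈ O (i + l) ∧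
          ¬ HoldsAt u (release ψ₀ ψ₁) (i + l) := by
        induction l with
        | zero => exact ⟨h, hn⟩
        | succ l ih =>
          have hn' := ih.2
          rw [holdsAt_release_iff] at hn'
          have h' := (hstep _).1 ih.1
          exact ⟨h'.2.resolve_left fun h'' => hn' ⟨h'.1, Or.inl h''⟩,
            fun h'' => hn' ⟨h'.1, Or.inr h''⟩⟩
      refine hn fun j hj => Or.inl ?_
      obtain ⟨l, rfl⟩ := Nat.exists_eq_add_of_le hj
      exact ((hstep _).1 (hall l).1).1
    · intro h
      by_contra hn
      -- While the formula is true but not labelled, `ψ₁` holds and `ψ₀` does not, so the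
      -- discrepancy moves on to the next position; a fair position ends it.
      have hall (l : ℕ) : (⟨release ψ₀ ψ₁, hψ⟩ : φ.Sub) ∉ O (i + l) ∧
          HoldsAt u (release ψ₀ ψ₁) (i + l) := by
        induction l with
        | zero => exact ⟨hn, h⟩
        | succ l ih =>
          have h' := holdsAt_release_iff.1 ih.2
          have hn' := fun h => ih.1 ((hstep _).2 h)
          exact ⟨fun h'' => hn' ⟨h'.1, Or.inr h''⟩,
            h'.2.resolve_left fun h'' => hn' ⟨h'.1, Or.inl h''⟩⟩
      obtain ⟨j, hj, h'⟩ := hf i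
      obtain ⟨l, rfl⟩ := Nat.exists_eq_add_of_le hj
      exact (hall l).1 (h' (holdsAt_release_iff.1 (hall l).2).1)

/-! ### Existence and uniqueness of the final run -/

/-- From any `i`, an `F` or `U` formula is false at `i`, hence fair there, or has a later witness
that is fair. A `G` or `R` formula is true at `i`, or the operand that it demands fails later. -/
theorem frequently_fair_holdsAt (u : ℕ → A) (ψ : LTL A) (hψ : ψ ∈ φ.subformulas) :
    ∃ᶠ i in atTop, Fair {q : φ.Sub | HoldsAt u q.1 i} ψ hψ := by
  refine frequently_atTop.2 fun i => ?_
  cases ψ with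
  | letter a | negLetter a | or ψ₀ ψ₁ | and ψ₀ ψ₁ | next ψ₀ => exact ⟨i, le_rfl, trivial⟩
  | eventually ψ₀ =>
    by_cases h : HoldsAt u (eventually ψ₀) i
    · obtain ⟨j, hj, h⟩ := h
      exact ⟨j, hj, fun _ => h⟩
    · exact ⟨i, le_rfl, fun h' => absurd h' h⟩
  | always ψ₀ =>
    by_cases h : HoldsAt u (always ψ₀) i
    · exact ⟨i, le_rfl, fun _ => h⟩
    · simp only [HoldsAt, not_forall] at h
      obtain ⟨j, hj, h⟩ := h
      exact ⟨j, hj, fun h' => absurd h' h⟩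
  | untl ψ₀ ψ₁ =>
    by_cases h : HoldsAt u (untl ψ₀ ψ₁) i
    · obtain ⟨j, hj, h, -⟩ := h
      exact ⟨j, hj, fun _ => h⟩
    · exact ⟨i, le_rfl, fun h' => absurd h' h⟩
  | release ψ₀ ψ₁ =>
    by_cases h : HoldsAt u (release ψ₀ ψ₁) i
    · exact ⟨i, le_rfl, fun _ => h⟩
    · simp only [HoldsAt, not_forall, not_or] at h
      obtain ⟨j, hj, h, -⟩ := h
      exact ⟨j, hj, fun h' => absurd h' h⟩

theorem exists_index (R : Set φ.Sub) (q : φ.Sub) :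
    ∃ j : (φ.toAlt R).toBackward.Index, q ∈ j.1.1 :=
  have hq : q ∈ (φ.toAlt R).scc q := (φ.toAlt R).mem_scc.2 ⟨.refl, .refl⟩
  ⟨⟨⟨(φ.toAlt R).scc q, q, rfl⟩, ⟨0, Finset.card_pos.2 ⟨q, hq⟩⟩⟩, hq⟩

theorem output_eq_of_isFinalRun {R : Set φ.Sub} (hR : φ.IsRecurringSet R) {u : ℕ → A}
    {r : ℕ → (φ.toAlt R).toBackward.State} (hr : (φ.toAlt R).toBackward.IsFinalRun u r) (i : ℕ) :
    (φ.toAlt R).output (r i) = {q | HoldsAt u q.1 i} := by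
  ext q
  refine mem_iff_holdsAt_of_frequently_fair (O := fun i => (φ.toAlt R).output (r i))
    (fun i q => ?_) (fun q => ?_) q.1 q.2 i
  · rw [hr.1 i]
    exact AltAutomaton.mem_acceptedStates_liftVal (isVeryWeak_toAlt R).isWeak
  · obtain ⟨j, hj⟩ := exists_index R q
    refine (hr.2 j).mono fun i hi => ?_
    rw [hr.1 i] at hi ⊢
    exact (mem_buchi_iff_fair hR hj _ _).1 hi

/-- The final run encodes the labelling by truth. Any other final run has the same output, and the
output determines the state. -/
theorem isBackwardDeterministic_toBackward {R : Set φ.Sub} (hR : φ.IsRecurringSet R) :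
    (φ.toAlt R).toBackward.IsBackwardDeterministic := by
  intro u
  have hA := isVeryWeak_toAlt (φ := φ) R
  choose w hw hw' using fun i => hA.exists_acceptedStates_eq {q : φ.Sub | HoldsAt u q.1 i}
  let r : ℕ → (φ.toAlt R).toBackward.State := fun i => ⟨w i, hw i⟩
  have hr : (φ.toAlt R).toBackward.IsRun u r := fun i => by
    refine Subtype.ext (hA.eq_of_acceptedStates_eq (hw i)
      ((φ.toAlt R).isValuation_liftVal (hw (i + 1)) (u i)) ?_)
    ext q
    refine Iff.trans ?_ (AltAutomaton.mem_acceptedStates_liftVal (w := w (i + 1)) hA.isWeak).symm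
    rw [hw' (i + 1)]
    exact (Set.ext_iff.1 (hw' i) q).trans (sat_trans_iff_holdsAt _ _).symm
  refine ⟨r, ⟨hr, fun j => ?_⟩, fun r' hr' => ?_⟩
  · obtain ⟨q, hq⟩ : ∃ q, q ∈ j.1.1 := Finset.card_pos.1 (Fin.pos j.2)
    refine (frequently_fair_holdsAt u q.1 q.2).mono fun i hi => ?_
    rw [hr i, mem_buchi_iff_fair hR hq, ← hr i]
    rw [← hw' i] at hi
    exact hi
  · funext i
    refine Subtype.ext (hA.eq_of_acceptedStates_eq (r' i).2 (hw i) ?_)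
    rw [hw' i]
    exact output_eq_of_isFinalRun hR hr' i

end LTL

theorem mainTheorem2 {A : Type u} (φ : LTL A) (n : ℕ) (hn : φ.size = n)
    (R : Set φ.Sub) (hR : φ.IsRecurringSet R) :
    -- the alternating automaton is very weak, hence weak, and equivalent to `φ`
    (φ.toAlt R).IsVeryWeak ∧ (φ.toAlt R).IsWeak ∧
    (∀ (w : ℕ → A) (i : ℕ) (q : φ.Sub),
      (φ.toAlt R).AcceptsFrom w i q ↔ LTL.HoldsAt w q.1 i) ∧
    -- the size of the resulting backward automaton
    Nat.card (φ.toAlt R).toBackward.State = 2 ^ n ∧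
    Nat.card (φ.toAlt R).toBackward.State ≤ 2 ^ φ.length ∧
    Nat.card (φ.toAlt R).toBackward.Index = n ∧
    -- its acceptance condition is also a state-based generalized Büchi condition
    (φ.toAlt R).toBackward.IsStateBased ∧
    -- it is backward deterministic and equivalent
    ∃ h : (φ.toAlt R).toBackward.IsBackwardDeterministic,
      BackwardAutomaton.computed h (φ.toAlt R).output = (φ.toAlt R).computed ∧
      BackwardAutomaton.language h {s | φ.top ∈ (φ.toAlt R).output s} = φ.language := by
  have hA := φ.isVeryWeak_toAlt R
  have hcard : Fintype.card φ.Sub = n := by rw [← hn, Fintype.card_coe, LTL.size]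
  refine ⟨hA, hA.isWeak, LTL.acceptsFrom_toAlt_iff hR, ?_, ?_, ?_, LTL.isStateBased_toBackward hR,
    LTL.isBackwardDeterministic_toBackward hR, ?_, ?_⟩
  · rw [hA.card_state, hcard]
  · rw [hA.card_state, hcard, ← hn]
    exact Nat.pow_le_pow_right two_pos φ.size_le_length
  · rw [hA.card_index, hcard]
  · funext u i
    refine (LTL.output_eq_of_isFinalRun hR
      (LTL.isBackwardDeterministic_toBackward hR u).choose_spec.1 i).trans ?_
    ext q
    exact (LTL.acceptsFrom_toAlt_iff hR u i q).symm
  · ext u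
    exact Set.ext_iff.1 (LTL.output_eq_of_isFinalRun hR
      (LTL.isBackwardDeterministic_toBackward hR u).choose_spec.1 0) φ.top
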